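/- Let $0<\lambda<\mu$ and $\rho=\lambda/\mu$. Consider a first-come first-served M/G/1 queue of updates with arrival rate $\lambda$, in which the service time $S$ has mean $1/\mu$ and is uniform on $[0,2/\mu]$ (case U), exponential (case E) or deterministic (case D). In steady state let $T$ be the system time of an update, $X\sim\mathrm{Exp}(\lambda)$ the time between its arrival and the next one, and $S$ the service time of the next update, where $T,X,S$ are independent and $\max(T-X,0)+S$ has the law of $T$. The inter-departure time is $Y=S$ if $X\le T$ and $Y=(X-T)+S$ if $X>T$. A decision made $u$ time units after the departure of the update with system time $T$ has age $T+u$. The average age upon decisions (AuD) is the expected sum of the ages at the decisions made during $Y$, divided by the expected number of these decisions. *Poisson decisions* of rate $\nu$ have independent $\mathrm{Exp}(\nu)$ inter-decision times; denote the average AuD by $\bar\Delta^{G/M}$, $G\in\{U,E,D\}$. *Periodic decisions* of rate $\nu=m_0\mu$ ($m_0\ge 1$ an integer) are treated in the uniform-phase approximation: the number of decisions during $Y$ is $N=N^1$ if $X\le T$ and $N=N^2+N^3$ if $X>T$, where $N^1,N^3$ count the epochs $a+i/\nu\le S$, $i\ge 0$, and $N^2$ counts the epochs $b+i/\nu\le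 X-T$, $i\ge0$, with phases $a,b$ independent, uniform on $(0,1/\nu)$ and independent of $(T,X,S)$; in the age of the decisions the time from the departure to the first decision is replaced by its mean $1/(2\nu)$, so the $j$-th decision has age $T+\frac1{2\nu}+\frac{j-1}{\nu}$. Thus the average AuD is $\bar\Delta^{G/D}(m_0)=\mathbb E\big[NT+\tfrac{N^2}{2\nu}\big]/\mathbb E[N]$. Put $$\begin{aligned} A_U&=\frac{\rho(6\rho^2e^{2\rho}-13\rho e^{2\rho}+9e^{2\rho}+\rho-3)}{3\lambda(1-\rho)(e^{2\rho}-1)},\\ A_E&=\frac{\rho^3-\rho^2+1}{\lambda(1-\rho)},\\ A_D&=\frac{\rho^2+2(1-\rho)(\rho+e^\rho-\rho e^\rho)}{2\lambda(1-\rho)}, \end{aligned}$$ and, with $\omega_0=e^{-\mu/\nu}=e^{-1/m_0}$ and $u_0=e^{-\lambda/\nu}=e^{-\rho/m_0}$, $$\begin{aligned} B_U(m_0)&=\frac{2e^{2\rho}(1-\rho)}{\mu(e^{2\rho}-1)}+\frac{(1-\rho)(1+u_0)}{2\mu m_0(1-u_0)}-\frac1{\mu\rho(1-\rho)}-\frac{(2m_0+1)\rho^2+(16m_0^2-1)\rho-36m_0^2-6m_0}{12m_0^2\mu(1-\rho)},\\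 B_E(m_0)&=\frac{2\rho^2-3\rho+2}{\mu(1-\rho)}+\frac{\rho(1+\omega_0)}{2\mu m_0(1-\omega_0)}+\frac{(1-\rho)(1+u_0)}{2\mu m_0(1-u_0)},\\ B_D(m_0)&=\frac{e^\rho(1-\rho)}{\mu\rho}+\frac{(1-\rho)(1+u_0)}{2\mu m_0(1-u_0)}+\frac{-3\rho^2+6\rho-2}{2\mu\rho(1-\rho)}. \end{aligned}$$ Then for each $G\in\{U,E,D\}$: 1. $\bar\Delta^{G/D}(m_0)\ge\bar\Delta^{G/M}$ for every integer $m_0\ge1$; $\bar\Delta^{G/D}(m_0)$ is strictly decreasing in $m_0\ge 1$; and $\bar\Delta^{G/D}(m_0)\to\bar\Delta^{G/M}$ as $m_0\to\infty$. Here $\bar\Delta^{G/M}=A_G$ for every decision rate $\nu>0$, and $\bar\Delta^{G/D}(m_0)=B_G(m_0)$ for $G\in\{E,D\}$. 2. The same holds for the explicit expressions: $B_G(m_0)\ge A_G$ for every integer $m_0\ge1$, $B_G(m_0)$ is strictly decreasing in $m_0\ge1$, and $B_G(m_0)\to A_G$ as $m_0\to\infty$. (For $G=U$ the expression $B_U$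 is a coarser approximation, slightly different from $\bar\Delta^{U/D}$.) -/

import Mathlib

open MeasureTheory ProbabilityTheory Filter Topology

/-- The three service processes. -/
inductive ServiceType
  | uniform
  | exponential
  | deterministic

/-- The law of a service time with mean `1 / mu`: uniform on `[0, 2 / mu]`, exponential of rate
`mu`, or equal to `1 / mu`. -/
noncomputable def serviceLaw (mu : ℝ) : ServiceType → Measure ℝ
  | .uniform => ProbabilityTheory.cond volume (Set.Icc 0 (2 / mu))
  | .exponential => expMeasure mu
  | .deterministic => Measure.dirac (1 / mu)

/-- The joint law of `(T, X, S)`: the system time `T` of the previous update (law `tau`), the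
inter-arrival time `X` (exponential of rate `lam`) and the service time `S` (law `G`) of the
current update; the three are independent. -/
noncomputable def queueLaw (lam : ℝ) (G tau : Measure ℝ) : Measure (ℝ × ℝ × ℝ) :=
  tau.prod ((expMeasure lam).prod G)

/-- `tau` is a steady-state law of the system time (waiting plus service) in the first-come
first-served M/G/1 queue: the system time `max (T - X) 0 + S` of the current update has the same
law as the system time `T` of the previous one. -/
structure IsSteadySystemTime (lam : ℝ) (G tau : Measure ℝ) : Prop where
  isProbabilityMeasure : IsProbabilityMeasure tau
  nonneg : ∀ᵐ t ∂tau, 0 ≤ t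
  stationary : (queueLaw lam G tau).map (fun p => max (p.1 - p.2.1) 0 + p.2.2) = tau

/-- The inter-departure time `Y` between the previous and the current update. -/
noncomputable def interDeparture (p : ℝ × ℝ × ℝ) : ℝ :=
  if p.2.1 ≤ p.1 then p.2.2 else (p.2.1 - p.1) + p.2.2

/-! ### Poisson decisions -/

/-- The mean measure of the decision epochs after a departure when the inter-decision times are
independent and exponential of rate `nu`: the `(j+1)`-st epoch is Erlang distributed. -/
noncomputable def poissonEpochs (nu : ℝ) : Measure ℝ :=
  Measure.sum (fun j : ℕ => gammaMeasure ((j : ℝ) + 1) nu)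

/-- Average age upon decisions of the M/G/1/M system in steady state: the expected sum of the ages
at the decisions made in an inter-departure time, over the expected number of these decisions.
A decision made `u` time units after the departure of an update with system time `t` has age
`t + u`. -/
noncomputable def poissonAuD (lam nu : ℝ) (G tau : Measure ℝ) : ℝ :=
  (∫ p, ∫ u in Set.Ioc 0 (interDeparture p), (p.1 + u) ∂(poissonEpochs nu) ∂(queueLaw lam G tau)) /
    ∫ p, (poissonEpochs nu).real (Set.Ioc 0 (interDeparture p)) ∂(queueLaw lam G tau)

/-! ### Periodic decisions, with approximately uniform phases -/

/-- The number of epochs `a, a + 1 / nu, a + 2 / nu, …` that are at most `y`. -/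
noncomputable def decisionCount (nu a y : ℝ) : ℕ :=
  Set.ncard {i : ℕ | a + (i : ℝ) / nu ≤ y}

/-- The number of decisions in an inter-departure time. If the current update has arrived before
the previous one departs, these are the decisions during its service; otherwise the decisions
during the idle time `X - T`, with phase `c.1`, are added. -/
noncomputable def periodicCount (nu : ℝ) (p : ℝ × ℝ × ℝ) (c : ℝ × ℝ) : ℕ :=
  (if p.2.1 ≤ p.1 then 0 else decisionCount nu c.1 (p.2.1 - p.1)) + decisionCount nu c.2 p.2.2

/-- The sum of the ages at these decisions. The time from the departure to the first decision is
taken at its mean `1 / (2 * nu)`, so that the `(j+1)`-st decision has age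
`T + 1 / (2 * nu) + j / nu`. -/
noncomputable def periodicAgeSum (nu : ℝ) (p : ℝ × ℝ × ℝ) (c : ℝ × ℝ) : ℝ :=
  ∑ j ∈ Finset.range (periodicCount nu p c), (p.1 + 1 / (2 * nu) + (j : ℝ) / nu)

/-- The law of the two phases: independent and uniform on `(0, 1 / nu)`. -/
noncomputable def phaseLaw (nu : ℝ) : Measure (ℝ × ℝ) :=
  (ProbabilityTheory.cond volume (Set.Ioo 0 (1 / nu))).prod
    (ProbabilityTheory.cond volume (Set.Ioo 0 (1 / nu)))

/-- Average age upon decisions of the M/G/1/D system in steady state, under the uniform-phase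
approximation: the expected sum of the ages at the decisions made in an inter-departure time, over
the expected number of these decisions. -/
noncomputable def periodicAuD (lam nu : ℝ) (G tau : Measure ℝ) : ℝ :=
  (∫ q, periodicAgeSum nu q.1 q.2 ∂((queueLaw lam G tau).prod (phaseLaw nu))) /
    ∫ q, (periodicCount nu q.1 q.2 : ℝ) ∂((queueLaw lam G tau).prod (phaseLaw nu))

/-! ### Explicit expressions -/

/-- The explicit average age upon decisions of the M/U/1/M, M/M/1/M and M/D/1/M systems, as a
function of the arrival rate `lam` and the utilization `r`. -/
noncomputable def poissonExpr (lam r : ℝ) : ServiceType → ℝ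
  | .uniform =>
      r * (6 * r ^ 2 * Real.exp (2 * r) - 13 * r * Real.exp (2 * r) + 9 * Real.exp (2 * r) + r - 3)
        / (3 * lam * (1 - r) * (Real.exp (2 * r) - 1))
  | .exponential => (r ^ 3 - r ^ 2 + 1) / (lam * (1 - r))
  | .deterministic =>
      (r ^ 2 + 2 * (1 - r) * (r + Real.exp r - r * Real.exp r)) / (2 * lam * (1 - r))

/-- The explicit approximate average age upon decisions of the M/U/1/D, M/M/1/D and M/D/1/D systems
with decision rate `m * mu`, where `w = exp (-mu / nu)` and `u = exp (-lam / nu)`. -/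
noncomputable def periodicExpr (mu r m w u : ℝ) : ServiceType → ℝ
  | .uniform =>
      2 * Real.exp (2 * r) * (1 - r) / (mu * (Real.exp (2 * r) - 1))
        + (1 - r) * (1 + u) / (2 * mu * m * (1 - u)) - 1 / (mu * r * (1 - r))
        - ((2 * m + 1) * r ^ 2 + (16 * m ^ 2 - 1) * r - 36 * m ^ 2 - 6 * m)
            / (12 * m ^ 2 * mu * (1 - r))
  | .exponential =>
      (2 * r ^ 2 - 3 * r + 2) / (mu * (1 - r)) + r * (1 + w) / (2 * mu * m * (1 - w))
        + (1 - r) * (1 + u) / (2 * mu * m * (1 - u))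
  | .deterministic =>
      Real.exp r * (1 - r) / (mu * r) + (1 - r) * (1 + u) / (2 * mu * m * (1 - u))
        + (-3 * r ^ 2 + 6 * r - 2) / (2 * mu * r * (1 - r))

/-- `poissonExpr` at utilization `lam / mu`. -/
noncomputable def poissonFormula (lam mu : ℝ) (G : ServiceType) : ℝ :=
  poissonExpr lam (lam / mu) G

/-- `periodicExpr` at utilization `lam / mu` and decision rate `m * mu`. -/
noncomputable def periodicFormula (lam mu : ℝ) (G : ServiceType) (m : ℕ) : ℝ :=
  periodicExpr mu (lam / mu) m (Real.exp (-(mu / (m * mu)))) (Real.exp (-(lam / (m * mu)))) G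

/-! Write `Z = max (X - T) 0` for the idle time, so `Y = Z + S`. Poisson decisions form a process of
constant intensity `ν`, so their average age is the time average `λ E[TY + Y²/2]`, with no
dependence on `ν` (`poissonAuD_eq`). For periodic decisions with uniform phases, the count in an
interval of length `y` is `⌊νy⌋` plus a Bernoulli variable whose parameter is the fractional part
`f` of `νy`: its mean is `νy` and its variance `f(1 - f)`. The half-step convention for the first
decision turns the sum of ages into `NT + N²/(2ν)`, so the means reproduce the Poisson value and
only the variances of the two independent counts remain as an excess (`periodicAuD_eq`).

By lack of memory, `Z` is positive with probability `E e^{-λT} = 1 - ρ`, and is then again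
exponential of rate `λ`. Its share of the excess is `(1 - ρ)/λ * (halfCoth (λ/ν) - 1)`, where
`halfCoth c = (c/2) coth (c/2)` increases strictly on `c > 0` and tends to 1 at 0
(`latticeVariance_expMeasure_excess`, `halfCoth_strictMonoOn`, `tendsto_halfCoth`). With `ν = mμ`
this share is strictly decreasing in `m`, with limit 0. The share of the service time is nonnegative
and nonincreasing for all three laws: a multiple of `1/m²` (uniform), another `halfCoth` term
(exponential), or zero (deterministic). A strictly decreasing sequence lies above its limit, which
gives the comparison.

The constants in the Poisson value need `E[T]`, `E[e^{-λT}]` and `E[T e^{-λT}]`. All three come from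
the Laplace transform of the stationarity equation: its first two orders at `s → 0` give the
empty-queue probability and the Pollaczek-Khinchine mean, and its value at `s = λ` gives the last
one. Finiteness of `E[T]` is not assumed; it is deduced from the transform. The explicit formulas
are then matched algebraically with the Poisson value plus an excess of the same shape
(`periodicFormula_eq`). -/

/-! ### The exponential law -/

lemma exponentialPDFReal_apply (r x : ℝ) :
    exponentialPDFReal r x = if 0 ≤ x then r * Real.exp (-(r * x)) else 0 := by
  simp [exponentialPDFReal, gammaPDFReal]

lemma expMeasure_eq_withDensity (r : ℝ) :
    expMeasure r = volume.withDensity (fun x => ENNReal.ofReal (exponentialPDFReal r x)) := rfl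

lemma integral_expMeasure {r : ℝ} (hr : 0 < r) (g : ℝ → ℝ) :
    ∫ x, g x ∂(expMeasure r) = ∫ x, exponentialPDFReal r x * g x := by
  rw [expMeasure_eq_withDensity, integral_withDensity_eq_integral_toReal_smul
    (measurable_exponentialPDFReal r).ennreal_ofReal (ae_of_all _ fun _ => ENNReal.ofReal_lt_top)]
  simp [ENNReal.toReal_ofReal (exponentialPDFReal_nonneg hr _)]

lemma integral_expMeasure_Ioi {r : ℝ} (hr : 0 < r) (g : ℝ → ℝ) :
    ∫ x, g x ∂(expMeasure r) = ∫ x in Set.Ioi 0, r * Real.exp (-(r * x)) * g x := by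
  rw [integral_expMeasure hr, ← integral_Ici_eq_integral_Ioi, ← integral_indicator measurableSet_Ici]
  congr 1 with x
  by_cases hx : 0 ≤ x <;> simp [exponentialPDFReal_apply, Set.indicator, hx]

lemma expMeasure_ae_pos (r : ℝ) : ∀ᵐ x ∂(expMeasure r), 0 < x := by
  have h : expMeasure r (Set.Iic 0) = 0 := by
    rw [expMeasure_eq_withDensity, withDensity_apply _ measurableSet_Iic,
      ← restrict_Iio_eq_restrict_Iic, setLIntegral_congr_fun measurableSet_Iio (g := fun _ => 0)]
    · simp
    · intro x hx
      simp [exponentialPDFReal_apply, not_le.2 (Set.mem_Iio.1 hx)]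
  rw [ae_iff]
  simp only [not_lt]
  exact h

lemma integral_Ioi_pow_mul_exp {r : ℝ} (hr : 0 < r) (n : ℕ) :
    ∫ x in Set.Ioi (0 : ℝ), x ^ n * Real.exp (-(r * x)) = n.factorial / r ^ (n + 1) := by
  have h := Real.integral_rpow_mul_exp_neg_mul_Ioi (a := (n : ℝ) + 1) (r := r) (by positivity) hr
  simp only [add_sub_cancel_right, Real.rpow_natCast, Real.Gamma_nat_eq_factorial] at h
  rw [h, show (n : ℝ) + 1 = ((n + 1 : ℕ) : ℝ) by push_cast; ring, Real.rpow_natCast,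
    one_div, inv_pow]
  ring

lemma integral_pow_expMeasure {r : ℝ} (hr : 0 < r) (n : ℕ) :
    ∫ x, x ^ n ∂(expMeasure r) = n.factorial / r ^ n := by
  rw [integral_expMeasure_Ioi hr]
  have : ∀ x : ℝ, r * Real.exp (-(r * x)) * x ^ n = r * (x ^ n * Real.exp (-(r * x))) := by
    intro x; ring
  simp only [this]
  rw [integral_const_mul, integral_Ioi_pow_mul_exp hr, pow_succ]
  field_simp

lemma integrable_pow_expMeasure {r : ℝ} (hr : 0 < r) (n : ℕ) :
    Integrable (fun x : ℝ => x ^ n) (expMeasure r) := by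
  -- A non-integrable function has Bochner integral 0, while the value already computed is positive.
  by_contra h
  have h1 := integral_pow_expMeasure hr n
  rw [integral_undef h] at h1
  have : (0 : ℝ) < n.factorial / r ^ n := by positivity
  linarith

lemma integral_id_expMeasure {r : ℝ} (hr : 0 < r) : ∫ x, x ∂(expMeasure r) = 1 / r := by
  simpa using integral_pow_expMeasure hr 1

lemma integrable_id_expMeasure {r : ℝ} (hr : 0 < r) :
    Integrable (fun x : ℝ => x) (expMeasure r) := by
  simpa using integrable_pow_expMeasure hr 1

lemma integral_sq_expMeasure {r : ℝ} (hr : 0 < r) : ∫ x, x ^ 2 ∂(expMeasure r) = 2 / r ^ 2 := by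
  simpa using integral_pow_expMeasure hr 2

lemma integral_exp_mul_expMeasure {r s : ℝ} (hr : 0 < r) (hs : s < r) :
    ∫ x, Real.exp (s * x) ∂(expMeasure r) = r / (r - s) := by
  rw [integral_expMeasure_Ioi hr]
  have : ∀ x : ℝ, r * Real.exp (-(r * x)) * Real.exp (s * x)
      = r * (x ^ 0 * Real.exp (-((r - s) * x))) := by
    intro x
    rw [mul_assoc, ← Real.exp_add, pow_zero, one_mul]
    ring_nf
  simp only [this]
  rw [integral_const_mul, integral_Ioi_pow_mul_exp (sub_pos.2 hs)]
  simp [div_eq_mul_inv]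

lemma integrable_exp_mul_expMeasure {r s : ℝ} (hr : 0 < r) (hs : s < r) :
    Integrable (fun x => Real.exp (s * x)) (expMeasure r) := by
  by_contra h
  have h1 := integral_exp_mul_expMeasure hr hs
  rw [integral_undef h] at h1
  have : 0 < r / (r - s) := div_pos hr (sub_pos.2 hs)
  linarith

/-- Lack of memory of the exponential law. -/
lemma integral_expMeasure_comp_sub {r : ℝ} (hr : 0 < r) {t : ℝ} (ht : 0 ≤ t) {g : ℝ → ℝ}
    (hg : ∀ z ≤ 0, g z = 0) :
    ∫ x, g (x - t) ∂(expMeasure r) = Real.exp (-(r * t)) * ∫ x, g x ∂(expMeasure r) := by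
  -- Translate Lebesgue measure by `t`. Where `g` is nonzero, both `x` and `x + t` lie in the
  -- support, and the ratio of the densities there is the constant `e^{-rt}`.
  rw [integral_expMeasure hr, integral_expMeasure hr, ← integral_const_mul,
    ← integral_add_right_eq_self _ t]
  congr 1 with x
  rw [add_sub_cancel_right]
  rcases le_or_gt x 0 with hx | hx
  · simp [hg x hx]
  · rw [exponentialPDFReal_apply, exponentialPDFReal_apply, if_pos (by linarith), if_pos hx.le,
      mul_add, neg_add, Real.exp_add]
    ring

lemma integral_posPart_expMeasure {r : ℝ} (hr : 0 < r) {t : ℝ} (ht : 0 ≤ t) :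
    ∫ x, max (x - t) 0 ∂(expMeasure r) = Real.exp (-(r * t)) / r := by
  rw [integral_expMeasure_comp_sub hr ht (g := fun z => max z 0) (fun z hz => max_eq_right hz),
    integral_congr_ae (g := fun x => x), integral_id_expMeasure hr, mul_one_div]
  filter_upwards [expMeasure_ae_pos r] with x hx using max_eq_left hx.le

lemma integral_posPart_sq_expMeasure {r : ℝ} (hr : 0 < r) {t : ℝ} (ht : 0 ≤ t) :
    ∫ x, max (x - t) 0 ^ 2 ∂(expMeasure r) = 2 * Real.exp (-(r * t)) / r ^ 2 := by
  rw [integral_expMeasure_comp_sub hr ht (g := fun z => max z 0 ^ 2)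
      (fun z hz => by simp [max_eq_right hz]),
    integral_congr_ae (g := fun x => x ^ 2), integral_sq_expMeasure hr]
  · ring
  · filter_upwards [expMeasure_ae_pos r] with x hx
    rw [max_eq_left hx.le]

/-- The transform of the waiting time after a system time `t`, below the arrival rate. -/
lemma integral_exp_waiting_of_lt {r s : ℝ} (hr : 0 < r) (hs : s < r) {t : ℝ} (ht : 0 ≤ t) :
    ∫ x, Real.exp (-(s * max (t - x) 0)) ∂(expMeasure r)
      = (r * Real.exp (-(s * t)) - s * Real.exp (-(r * t))) / (r - s) := by
  have := isProbabilityMeasure_expMeasure hr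
  have hi := integrable_exp_mul_expMeasure hr hs
  -- The pure exponential `e^{-s(t-x)}` is correct for `x ≤ t`; for `x > t` the true value is 1, and
  -- `g (x - t)` is the correction, to which lack of memory applies.
  set g : ℝ → ℝ := fun z => (Set.Ioi 0).indicator (fun z => 1 - Real.exp (s * z)) z with hgdef
  have hg : ∀ z ≤ 0, g z = 0 := fun z hz => by simp [hgdef, not_lt.2 hz]
  have hsplit : ∀ x, Real.exp (-(s * max (t - x) 0))
      = Real.exp (-(s * t)) * Real.exp (s * x) + g (x - t) := by
    intro x
    rw [← Real.exp_add]
    rcases le_or_gt x t with hx | hx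
    · rw [hg _ (by linarith), max_eq_left (by linarith)]
      ring_nf
    · rw [max_eq_right (by linarith)]
      have : x - t ∈ Set.Ioi (0 : ℝ) := by simpa using hx
      simp only [hgdef, Set.indicator_of_mem this]
      ring_nf
      simp
  have hgi : ∫ x, g x ∂(expMeasure r) = 1 - r / (r - s) := by
    rw [integral_congr_ae (g := fun x => 1 - Real.exp (s * x)),
      integral_sub (integrable_const _) hi, integral_exp_mul_expMeasure hr hs]
    · simp
    · filter_upwards [expMeasure_ae_pos r] with x hx
      simp [hgdef, hx]
  have hint : Integrable (fun x => g (x - t)) (expMeasure r) := by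
    have hmeas : Measurable g := Measurable.indicator (by fun_prop) measurableSet_Ioi
    have h1 : Integrable (fun x => Real.exp (-(s * max (t - x) 0))
        - Real.exp (-(s * t)) * Real.exp (s * x)) (expMeasure r) := by
      refine Integrable.sub ?_ (hi.const_mul _)
      -- The sign of `s` is free: the bound is 1 for `s ≥ 0` and `e^{-st}` for `s < 0`, and the
      -- constant covers both.
      refine Integrable.mono' ((integrable_const (1 + Real.exp (-(s * t))))) (by fun_prop) ?_
      filter_upwards [expMeasure_ae_pos r] with x hx
      rw [Real.norm_eq_abs, Real.abs_exp]
      rcases le_or_gt 0 s with h0 | h0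
      · have : Real.exp (-(s * max (t - x) 0)) ≤ 1 :=
          Real.exp_le_one_iff.2 (by have := mul_nonneg h0 (le_max_right (t - x) 0); linarith)
        have := Real.exp_pos (-(s * t))
        linarith
      · have : Real.exp (-(s * max (t - x) 0)) ≤ Real.exp (-(s * t)) := by
          apply Real.exp_le_exp.2
          have : max (t - x) 0 ≤ t := max_le (by linarith) ht
          nlinarith
        linarith
    refine h1.congr (ae_of_all _ fun x => ?_)
    simp only [hsplit x]
    ring
  simp only [hsplit]
  rw [integral_add (hi.const_mul _) hint, integral_const_mul, integral_exp_mul_expMeasure hr hs,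
    integral_expMeasure_comp_sub hr ht hg, hgi]
  have : r - s ≠ 0 := (sub_pos.2 hs).ne'
  field_simp
  ring

/-- The transform of the waiting time after a system time `t`, at the arrival rate. -/
lemma integral_exp_waiting_self {r : ℝ} (hr : 0 < r) {t : ℝ} (ht : 0 ≤ t) :
    ∫ x, Real.exp (-(r * max (t - x) 0)) ∂(expMeasure r) = Real.exp (-(r * t)) * (1 + r * t) := by
  have := isProbabilityMeasure_expMeasure hr
  set g : ℝ → ℝ := (Set.Ioi 0).indicator (fun _ => 1) with hgdef
  have hg : ∀ z ≤ 0, g z = 0 := fun z hz => by simp [hgdef, not_lt.2 hz]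
  have hmeas : Measurable g := measurable_const.indicator measurableSet_Ioi
  -- At `s = r` the function `e^{sx}` is no longer integrable against the exponential law, so the
  -- exponential is cut off at `t` instead of being corrected beyond it.
  set k : ℝ → ℝ := (Set.Iic t).indicator (fun x => Real.exp (-(r * (t - x)))) with hkdef
  have hkmeas : Measurable k := Measurable.indicator (by fun_prop) measurableSet_Iic
  have hsplit : ∀ x, Real.exp (-(r * max (t - x) 0)) = k x + g (x - t) := by
    intro x
    rcases le_or_gt x t with hx | hx
    · rw [hg _ (by linarith), max_eq_left (by linarith)]
      simp [hkdef, hx]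
    · rw [max_eq_right (by linarith)]
      simp [hkdef, hgdef, hx]
  have hgi : ∫ x, g x ∂(expMeasure r) = 1 := by
    rw [integral_congr_ae (g := fun x => 1)]
    · simp
    · filter_upwards [expMeasure_ae_pos r] with x hx
      simp [hgdef, hx]
  have hki : Integrable k (expMeasure r) := by
    refine Integrable.mono' (integrable_const 1) hkmeas.aestronglyMeasurable (ae_of_all _ fun x => ?_)
    by_cases hx : x ≤ t
    · simp only [hkdef, Set.indicator_of_mem (Set.mem_Iic.2 hx), Real.norm_eq_abs, Real.abs_exp]
      exact Real.exp_le_one_iff.2 (by nlinarith)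
    · simp [hkdef, hx]
  have hgint : Integrable (fun x => g (x - t)) (expMeasure r) := by
    refine Integrable.mono' (integrable_const 1)
      (hmeas.comp (measurable_id.sub_const t)).aestronglyMeasurable (ae_of_all _ fun x => ?_)
    by_cases hx : t < x <;> simp [hgdef, hx]
  have hk : ∫ x, k x ∂(expMeasure r) = r * t * Real.exp (-(r * t)) := by
    rw [integral_expMeasure_Ioi hr]
    -- The density cancels the growth of `k`, leaving a constant on `(0, t]`; this produces the
    -- linear factor `r t`.
    have h1 : ∀ x, r * Real.exp (-(r * x)) * k x
        = (Set.Iic t).indicator (fun _ => r * Real.exp (-(r * t))) x := by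
      intro x
      by_cases hx : x ≤ t
      · simp only [hkdef, Set.indicator_of_mem (Set.mem_Iic.2 hx)]
        rw [mul_assoc, ← Real.exp_add]
        ring_nf
      · simp [hkdef, hx]
    simp only [h1]
    rw [integral_indicator measurableSet_Iic, Measure.restrict_restrict measurableSet_Iic,
      Set.inter_comm, Set.Ioi_inter_Iic, setIntegral_const]
    simp [ht]
    ring
  simp only [hsplit]
  rw [integral_add hki hgint, hk, integral_expMeasure_comp_sub hr ht hg, hgi]
  ring

/-! ### Laplace transforms of laws on the half-line -/

/-- The Laplace transform of a measure on the real line. -/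
noncomputable def laplace (μ : Measure ℝ) (s : ℝ) : ℝ := ∫ x, Real.exp (-(s * x)) ∂μ

/-- Follows from `1 + y + y²/2 ≤ e^y` and `(1 + y + y²/2)(1 - y + y²/2) = 1 + y⁴/4 ≥ 1`. -/
lemma exp_neg_le_quadratic {y : ℝ} (hy : 0 ≤ y) : Real.exp (-y) ≤ 1 - y + y ^ 2 / 2 := by
  have h := Real.quadratic_le_exp_of_nonneg hy
  rw [Real.exp_neg, inv_le_comm₀ (Real.exp_pos _) (by nlinarith [sq_nonneg (y - 1)])]
  refine le_trans ?_ h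
  rw [inv_le_iff_one_le_mul₀ (by nlinarith [sq_nonneg (y - 1)])]
  nlinarith [sq_nonneg (y ^ 2)]

lemma tendsto_one_sub_exp_div (x : ℝ) :
    Tendsto (fun s : ℝ => (1 - Real.exp (-(s * x))) / s) (𝓝[>] 0) (𝓝 x) := by
  have h : HasDerivAt (fun s : ℝ => 1 - Real.exp (-(s * x))) x 0 := by
    have := (((hasDerivAt_id (0 : ℝ)).mul_const x).neg.exp).const_sub 1
    simpa using this
  have h2 := h.tendsto_slope_zero_right
  simpa [div_eq_inv_mul] using h2

lemma tendsto_exp_remainder_div {x : ℝ} (hx : 0 ≤ x) :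
    Tendsto (fun s : ℝ => (x - (1 - Real.exp (-(s * x))) / s) / s) (𝓝[>] 0) (𝓝 (x ^ 2 / 2)) := by
  have hlim : Tendsto (fun s : ℝ => s * x ^ 3) (𝓝[>] 0) (𝓝 0) := by
    have : Tendsto (fun s : ℝ => s * x ^ 3) (𝓝 0) (𝓝 (0 * x ^ 3)) :=
      (continuous_mul_const (x ^ 3)).tendsto 0
    rw [zero_mul] at this
    exact this.mono_left nhdsWithin_le_nhds
  rw [tendsto_iff_norm_sub_tendsto_zero]
  refine squeeze_zero' (Eventually.of_forall fun _ => norm_nonneg _) ?_ hlim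
  have hsmall : ∀ᶠ s : ℝ in 𝓝[>] 0, s * x ≤ 1 := by
    have : Tendsto (fun s : ℝ => s * x) (𝓝[>] 0) (𝓝 0) := by
      have : Tendsto (fun s : ℝ => s * x) (𝓝 0) (𝓝 (0 * x)) := (continuous_mul_const x).tendsto 0
      rw [zero_mul] at this
      exact this.mono_left nhdsWithin_le_nhds
    exact this.eventually_le_const one_pos
  filter_upwards [hsmall, self_mem_nhdsWithin] with s hs (hs0 : 0 < s)
  have hsx : 0 ≤ s * x := by positivity
  -- The Taylor remainder is of order `(s x)³`; after division by `s²` it is at most `s x³`.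
  have hb := Real.exp_bound (x := -(s * x)) (by rwa [abs_neg, abs_of_nonneg hsx])
    (n := 3) (by norm_num)
  simp only [Finset.sum_range_succ, Finset.sum_range_zero, Nat.factorial, abs_neg,
    abs_of_nonneg hsx] at hb
  norm_num at hb
  have heq : (x - (1 - Real.exp (-(s * x))) / s) / s - x ^ 2 / 2
      = (Real.exp (-(s * x)) - (1 + -(s * x) + (s * x) ^ 2 / 2)) / s ^ 2 := by
    field_simp
    ring
  rw [heq, Real.norm_eq_abs, abs_div, abs_of_pos (by positivity : 0 < s ^ 2),
    div_le_iff₀ (by positivity)]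
  refine hb.trans ?_
  have : 0 ≤ s ^ 3 * x ^ 3 := by positivity
  nlinarith

section

variable {μ : Measure ℝ} [IsProbabilityMeasure μ]

lemma integrable_exp_neg_mul (h0 : ∀ᵐ x ∂μ, 0 ≤ x) {s : ℝ} (hs : 0 ≤ s) :
    Integrable (fun x => Real.exp (-(s * x))) μ := by
  refine Integrable.mono' (integrable_const 1) (by fun_prop) ?_
  filter_upwards [h0] with x hx
  rw [Real.norm_eq_abs, Real.abs_exp, Real.exp_le_one_iff]
  have := mul_nonneg hs hx
  linarith

lemma laplace_pos (h0 : ∀ᵐ x ∂μ, 0 ≤ x) {s : ℝ} (hs : 0 ≤ s) : 0 < laplace μ s :=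
  integral_exp_pos (integrable_exp_neg_mul h0 hs)

lemma integral_one_sub_exp_div (h0 : ∀ᵐ x ∂μ, 0 ≤ x) {s : ℝ} (hs : 0 ≤ s) :
    ∫ x, (1 - Real.exp (-(s * x))) / s ∂μ = (1 - laplace μ s) / s := by
  rw [integral_div, integral_sub (integrable_const _) (integrable_exp_neg_mul h0 hs)]
  simp [laplace]

lemma one_sub_exp_div_nonneg {s x : ℝ} (hs : 0 < s) (hx : 0 ≤ x) :
    0 ≤ (1 - Real.exp (-(s * x))) / s := by
  refine div_nonneg (sub_nonneg.2 (Real.exp_le_one_iff.2 ?_)) hs.le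
  have := mul_nonneg hs.le hx
  linarith

lemma one_sub_exp_div_le {s x : ℝ} (hs : 0 < s) : (1 - Real.exp (-(s * x))) / s ≤ x := by
  rw [div_le_iff₀ hs]
  have := Real.add_one_le_exp (-(s * x))
  linarith

lemma tendsto_laplace (h0 : ∀ᵐ x ∂μ, 0 ≤ x) : Tendsto (laplace μ) (𝓝[>] 0) (𝓝 1) := by
  have h : Tendsto (laplace μ) (𝓝[>] 0) (𝓝 (∫ _, (1 : ℝ) ∂μ)) := by
    refine tendsto_integral_filter_of_dominated_convergence (fun _ => 1)
      (Eventually.of_forall fun _ => by fun_prop) ?_ (integrable_const _) (ae_of_all _ fun x => ?_)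
    · filter_upwards [self_mem_nhdsWithin] with s (hs : 0 < s)
      filter_upwards [h0] with x hx
      rw [Real.norm_eq_abs, Real.abs_exp, Real.exp_le_one_iff]
      have := mul_nonneg hs.le hx
      linarith
    · have : Tendsto (fun s : ℝ => Real.exp (-(s * x))) (𝓝 0) (𝓝 (Real.exp (-(0 * x)))) :=
        Continuous.tendsto (by fun_prop) 0
      simp only [zero_mul, neg_zero, Real.exp_zero] at this
      exact this.mono_left nhdsWithin_le_nhds
  simpa using h

lemma tendsto_one_sub_laplace_div (h0 : ∀ᵐ x ∂μ, 0 ≤ x) (h1 : Integrable (fun x => x) μ) :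
    Tendsto (fun s => (1 - laplace μ s) / s) (𝓝[>] 0) (𝓝 (∫ x, x ∂μ)) := by
  have h : Tendsto (fun s => ∫ x, (1 - Real.exp (-(s * x))) / s ∂μ) (𝓝[>] 0) (𝓝 (∫ x, x ∂μ)) := by
    refine tendsto_integral_filter_of_dominated_convergence (fun x => x)
      (Eventually.of_forall fun _ => by fun_prop) ?_ h1
      (ae_of_all _ fun x => tendsto_one_sub_exp_div x)
    filter_upwards [self_mem_nhdsWithin] with s (hs : 0 < s)
    filter_upwards [h0] with x hx
    rw [Real.norm_eq_abs, abs_of_nonneg (one_sub_exp_div_nonneg hs hx)]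
    exact one_sub_exp_div_le hs
  refine h.congr' ?_
  filter_upwards [self_mem_nhdsWithin] with s (hs : 0 < s)
  exact integral_one_sub_exp_div h0 hs.le

/-- Dominated convergence at second order, with `x²/2` as the dominating function by
`exp_neg_le_quadratic`. -/
lemma tendsto_laplace_remainder_div (h0 : ∀ᵐ x ∂μ, 0 ≤ x) (h1 : Integrable (fun x => x) μ)
    (h2 : Integrable (fun x => x ^ 2) μ) :
    Tendsto (fun s => (∫ x, x ∂μ - (1 - laplace μ s) / s) / s) (𝓝[>] 0)
      (𝓝 ((∫ x, x ^ 2 ∂μ) / 2)) := by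
  have h : Tendsto (fun s => ∫ x, (x - (1 - Real.exp (-(s * x))) / s) / s ∂μ) (𝓝[>] 0)
      (𝓝 (∫ x, x ^ 2 / 2 ∂μ)) := by
    refine tendsto_integral_filter_of_dominated_convergence (fun x => x ^ 2 / 2)
      (Eventually.of_forall fun _ => by fun_prop) ?_ (h2.div_const _)
      (by filter_upwards [h0] with x hx using tendsto_exp_remainder_div hx)
    filter_upwards [self_mem_nhdsWithin] with s (hs : 0 < s)
    filter_upwards [h0] with x hx
    rw [Real.norm_eq_abs, abs_of_nonneg (div_nonneg (sub_nonneg.2 (one_sub_exp_div_le hs)) hs.le),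
      div_le_iff₀ hs, sub_le_iff_le_add, ← sub_le_iff_le_add', le_div_iff₀ hs]
    have := exp_neg_le_quadratic (mul_nonneg hs.le hx)
    nlinarith
  rw [integral_div] at h
  refine h.congr' ?_
  filter_upwards [self_mem_nhdsWithin] with s (hs : 0 < s)
  have hi : Integrable (fun x => (1 - Real.exp (-(s * x))) / s) μ :=
    ((integrable_const _).sub (integrable_exp_neg_mul h0 hs.le)).div_const _
  rw [integral_div, integral_sub h1 hi, integral_one_sub_exp_div h0 hs.le]

/-- A law on the half-line whose Laplace transform has a right derivative at the origin has a
finite mean. -/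
lemma integrable_of_tendsto_laplace (h0 : ∀ᵐ x ∂μ, 0 ≤ x) {L : ℝ}
    (h : Tendsto (fun s => (1 - laplace μ s) / s) (𝓝[>] 0) (𝓝 L)) :
    Integrable (fun x => x) μ := by
  -- Fatou's lemma along `s = 1/(n+1)`: the nonnegative quotients converge pointwise to `x`, and
  -- their integrals have the finite limit `L`.
  have hu : Tendsto (fun n : ℕ => 1 / ((n : ℝ) + 1)) atTop (𝓝[>] 0) :=
    tendsto_nhdsWithin_iff.2 ⟨tendsto_one_div_add_atTop_nhds_zero_nat,
      Eventually.of_forall fun n => by simp only [Set.mem_Ioi]; positivity⟩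
  refine integrable_of_tendsto
    (G := fun n x => (1 - Real.exp (-(1 / ((n : ℝ) + 1) * x))) / (1 / ((n : ℝ) + 1)))
    (ae_of_all _ fun x => (tendsto_one_sub_exp_div x).comp hu) (fun n => by fun_prop) ?_
  have heq : ∀ n : ℕ, ∫⁻ x, ‖(1 - Real.exp (-(1 / ((n : ℝ) + 1) * x))) / (1 / ((n : ℝ) + 1))‖ₑ ∂μ
      = ENNReal.ofReal ((1 - laplace μ (1 / ((n : ℝ) + 1))) / (1 / ((n : ℝ) + 1))) := by
    intro n
    have hn : 0 < 1 / ((n : ℝ) + 1) := by positivity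
    rw [← integral_one_sub_exp_div h0 hn.le, ofReal_integral_eq_lintegral_ofReal]
    · refine lintegral_congr_ae ?_
      filter_upwards [h0] with x hx
      rw [Real.enorm_eq_ofReal (one_sub_exp_div_nonneg hn hx)]
    · exact ((integrable_const _).sub (integrable_exp_neg_mul h0 hn.le)).div_const _
    · filter_upwards [h0] with x hx using one_sub_exp_div_nonneg hn hx
  simp only [heq]
  have := (ENNReal.tendsto_ofReal (h.comp hu)).liminf_eq
  simp only [Function.comp_def] at this
  rw [this]
  exact ENNReal.ofReal_ne_top

end

/-! ### The stationary system time -/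

/-- A law of nonnegative service times with a finite second moment. -/
structure IsServiceLaw (G : Measure ℝ) : Prop where
  isProbabilityMeasure : IsProbabilityMeasure G
  nonneg : ∀ᵐ s ∂G, 0 ≤ s
  integrable_sq : Integrable (fun s => s ^ 2) G

lemma IsServiceLaw.integrable {G : Measure ℝ} (hG : IsServiceLaw G) :
    Integrable (fun s => s) G := by
  have := hG.isProbabilityMeasure
  refine Integrable.mono' ((integrable_const 1).add hG.integrable_sq) (by fun_prop)
    (ae_of_all _ fun x => ?_)
  simp only [Pi.add_apply, Real.norm_eq_abs]
  exact abs_le.2 ⟨by nlinarith [sq_nonneg (x + 1)], by nlinarith [sq_nonneg (x - 1)]⟩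

lemma isProbabilityMeasure_queueLaw {lam : ℝ} (hlam : 0 < lam) (G tau : Measure ℝ)
    [IsProbabilityMeasure G] [IsProbabilityMeasure tau] :
    IsProbabilityMeasure (queueLaw lam G tau) := by
  have := isProbabilityMeasure_expMeasure hlam
  unfold queueLaw
  infer_instance

lemma queueLaw_ae_nonneg {lam : ℝ} (hlam : 0 < lam) {G tau : Measure ℝ}
    [IsProbabilityMeasure G] [IsProbabilityMeasure tau]
    (hG : ∀ᵐ s ∂G, 0 ≤ s) (htau : ∀ᵐ t ∂tau, 0 ≤ t) :
    ∀ᵐ p ∂(queueLaw lam G tau), 0 ≤ p.1 ∧ 0 < p.2.1 ∧ 0 ≤ p.2.2 := by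
  have := isProbabilityMeasure_expMeasure hlam
  have h1 : ∀ᵐ p ∂(queueLaw lam G tau), 0 ≤ p.1 :=
    Measure.quasiMeasurePreserving_fst.ae htau
  have h2 : ∀ᵐ p ∂(queueLaw lam G tau), 0 < p.2.1 :=
    Measure.quasiMeasurePreserving_snd.ae
      (Measure.quasiMeasurePreserving_fst.ae (expMeasure_ae_pos lam))
  have h3 : ∀ᵐ p ∂(queueLaw lam G tau), 0 ≤ p.2.2 :=
    Measure.quasiMeasurePreserving_snd.ae (Measure.quasiMeasurePreserving_snd.ae hG)
  filter_upwards [h1, h2, h3] with p a b c using ⟨a, b, c⟩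

section

variable {lam : ℝ} {G tau : Measure ℝ}

/-- The service time is independent of the waiting time, so the transform of their sum factors. -/
lemma laplace_stationary (hlam : 0 < lam) (hG : IsServiceLaw G)
    (htau : IsSteadySystemTime lam G tau) {s : ℝ} (hs : 0 ≤ s) :
    laplace tau s
      = (∫ t, ∫ x, Real.exp (-(s * max (t - x) 0)) ∂(expMeasure lam) ∂tau) * laplace G s := by
  have := isProbabilityMeasure_expMeasure hlam
  have := hG.isProbabilityMeasure
  have := htau.isProbabilityMeasure
  have := isProbabilityMeasure_queueLaw hlam G tau
  have hint : Integrable (fun p : ℝ × ℝ × ℝ => Real.exp (-(s * (max (p.1 - p.2.1) 0 + p.2.2))))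
      (queueLaw lam G tau) := by
    refine Integrable.mono' (integrable_const 1) (by fun_prop) ?_
    filter_upwards [queueLaw_ae_nonneg hlam hG.nonneg htau.nonneg] with p hp
    rw [Real.norm_eq_abs, Real.abs_exp, Real.exp_le_one_iff]
    have := mul_nonneg hs (add_nonneg (le_max_right (p.1 - p.2.1) 0) hp.2.2)
    linarith
  have h1 : laplace tau s
      = ∫ p, Real.exp (-(s * (max (p.1 - p.2.1) 0 + p.2.2))) ∂(queueLaw lam G tau) := by
    conv_lhs => rw [laplace, ← htau.stationary]
    rw [integral_map (by fun_prop) (by fun_prop)]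
  rw [h1, queueLaw, integral_prod _ hint, ← integral_mul_const]
  congr 1 with t
  rw [laplace, ← integral_prod_mul]
  congr 1 with q
  rw [← Real.exp_add]
  ring_nf

/-- The waiting-time transform is explicit below the arrival rate, which makes stationarity linear
in the transform of `T`. Its only other unknown is the value at `lam`. -/
lemma laplace_stationary_of_lt (hlam : 0 < lam) (hG : IsServiceLaw G)
    (htau : IsSteadySystemTime lam G tau) {s : ℝ} (hs : 0 ≤ s) (hs' : s < lam) :
    (lam - s) * laplace tau s
      = (lam * laplace tau s - s * laplace tau lam) * laplace G s := by
  have := htau.isProbabilityMeasure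
  have h0 := htau.nonneg
  have h := laplace_stationary hlam hG htau hs
  rw [integral_congr_ae (g := fun t => (lam * Real.exp (-(s * t)) - s * Real.exp (-(lam * t)))
      / (lam - s)), integral_div, integral_sub ((integrable_exp_neg_mul h0 hs).const_mul _)
      ((integrable_exp_neg_mul h0 hlam.le).const_mul _), integral_const_mul,
      integral_const_mul] at h
  · change laplace tau s
      = (lam * laplace tau s - s * laplace tau lam) / (lam - s) * laplace G s at h
    have : lam - s ≠ 0 := (sub_pos.2 hs').ne'
    field_simp at h
    linear_combination h
  · filter_upwards [h0] with t ht using integral_exp_waiting_of_lt hlam hs' ht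

lemma integrable_mul_exp_neg {μ : Measure ℝ} [IsProbabilityMeasure μ] (h0 : ∀ᵐ t ∂μ, 0 ≤ t)
    (hlam : 0 < lam) : Integrable (fun t => t * Real.exp (-(lam * t))) μ := by
  refine Integrable.mono' (integrable_const (1 / lam)) (by fun_prop) ?_
  filter_upwards [h0] with t ht
  rw [Real.norm_eq_abs, abs_of_nonneg (by positivity), Real.exp_neg, ← div_eq_mul_inv,
    div_le_div_iff₀ (Real.exp_pos _) hlam]
  have := Real.add_one_le_exp (lam * t)
  linarith

/-- The boundary case of the functional equation brings in `E[T e^{-λT}]`, which is needed because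
the idle time depends on `T`. -/
lemma laplace_stationary_self (hlam : 0 < lam) (hG : IsServiceLaw G)
    (htau : IsSteadySystemTime lam G tau) :
    laplace tau lam
      = (laplace tau lam + lam * ∫ t, t * Real.exp (-(lam * t)) ∂tau) * laplace G lam := by
  have := htau.isProbabilityMeasure
  have h0 := htau.nonneg
  have h := laplace_stationary hlam hG htau hlam.le
  rw [integral_congr_ae (g := fun t => Real.exp (-(lam * t)) + lam * (t * Real.exp (-(lam * t)))),
      integral_add (integrable_exp_neg_mul h0 hlam.le)
      ((integrable_mul_exp_neg h0 hlam).const_mul _), integral_const_mul] at h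
  · exact h
  · filter_upwards [h0] with t ht
    rw [integral_exp_waiting_self hlam ht]
    ring

/-- In steady state the probability that an update finds the queue empty is `1 - ρ`. -/
lemma laplace_steady_rate (hlam : 0 < lam) (hG : IsServiceLaw G)
    (htau : IsSteadySystemTime lam G tau) :
    laplace tau lam = 1 - lam * ∫ s, s ∂G := by
  have := htau.isProbabilityMeasure
  have := hG.isProbabilityMeasure
  -- Divided by `s`, the functional equation says that this function equals the one in `hr`; the two
  -- limits at 0 are then compared.
  have hl : Tendsto (fun s => laplace tau s * (1 - lam * ((1 - laplace G s) / s))) (𝓝[>] 0)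
      (𝓝 (1 * (1 - lam * ∫ s, s ∂G))) :=
    (tendsto_laplace htau.nonneg).mul
      (((tendsto_one_sub_laplace_div hG.nonneg hG.integrable).const_mul lam).const_sub 1)
  have hr : Tendsto (fun s => laplace G s * laplace tau lam) (𝓝[>] 0)
      (𝓝 (1 * laplace tau lam)) := (tendsto_laplace hG.nonneg).mul_const _
  rw [one_mul] at hl hr
  refine tendsto_nhds_unique (hr.congr' ?_) hl
  filter_upwards [Ioo_mem_nhdsGT hlam] with s hs
  have h := laplace_stationary_of_lt hlam hG htau hs.1.le hs.2
  have : s ≠ 0 := hs.1.ne'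
  field_simp
  linear_combination h

lemma tendsto_one_sub_laplace_steady_div (hlam : 0 < lam) (hG : IsServiceLaw G)
    (htau : IsSteadySystemTime lam G tau) (hrho : lam * ∫ s, s ∂G < 1) :
    Tendsto (fun s => (1 - laplace tau s) / s) (𝓝[>] 0)
      (𝓝 (∫ s, s ∂G + lam * (∫ s, s ^ 2 ∂G) / (2 * (1 - lam * ∫ s, s ∂G)))) := by
  have := htau.isProbabilityMeasure
  have := hG.isProbabilityMeasure
  set m := ∫ s, s ∂G
  have hg1 := tendsto_one_sub_laplace_div hG.nonneg hG.integrable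
  have hg2 := tendsto_laplace_remainder_div hG.nonneg hG.integrable hG.integrable_sq
  have hden := (hg1.const_mul lam).const_sub 1
  have hpos : 0 < 1 - lam * m := by linarith
  -- With `g = (1 - laplace G s)/s`, the functional equation rearranges to `(1 - laplace tau s)/s *
  -- (1 - lam g) = lam (m - g)/s + g (1 - lam m)`, whose terms all have known limits.
  have h := ((hg2.const_mul lam).add (hg1.mul_const (1 - lam * m))).div hden hpos.ne'
  have hlim : (lam * ((∫ s, s ^ 2 ∂G) / 2) + m * (1 - lam * m)) / (1 - lam * m)
      = m + lam * (∫ s, s ^ 2 ∂G) / (2 * (1 - lam * m)) := by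
    field_simp
    ring
  rw [hlim] at h
  refine h.congr' ?_
  filter_upwards [Ioo_mem_nhdsGT hlam, hden.eventually_const_lt hpos] with s hs hds
  have h := laplace_stationary_of_lt hlam hG htau hs.1.le hs.2
  rw [laplace_steady_rate hlam hG htau] at h
  change (lam - s) * _ = (_ - s * (1 - lam * m)) * _ at h
  have hs0 : s ≠ 0 := hs.1.ne'
  simp only [Pi.div_apply]
  rw [div_eq_iff hds.ne']
  field_simp
  linear_combination -h

/-- The mean system time is finite. -/
lemma integrable_steady (hlam : 0 < lam) (hG : IsServiceLaw G)
    (htau : IsSteadySystemTime lam G tau) (hrho : lam * ∫ s, s ∂G < 1) :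
    Integrable (fun t => t) tau :=
  have := htau.isProbabilityMeasure
  integrable_of_tendsto_laplace htau.nonneg
    (tendsto_one_sub_laplace_steady_div hlam hG htau hrho)

/-- The Pollaczek-Khinchine formula for the mean system time. -/
lemma integral_steady (hlam : 0 < lam) (hG : IsServiceLaw G)
    (htau : IsSteadySystemTime lam G tau) (hrho : lam * ∫ s, s ∂G < 1) :
    ∫ t, t ∂tau = ∫ s, s ∂G + lam * (∫ s, s ^ 2 ∂G) / (2 * (1 - lam * ∫ s, s ∂G)) :=
  have := htau.isProbabilityMeasure
  tendsto_nhds_unique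
    (tendsto_one_sub_laplace_div htau.nonneg (integrable_steady hlam hG htau hrho))
    (tendsto_one_sub_laplace_steady_div hlam hG htau hrho)

lemma integral_mul_exp_steady (hlam : 0 < lam) (hG : IsServiceLaw G)
    (htau : IsSteadySystemTime lam G tau) :
    ∫ t, t * Real.exp (-(lam * t)) ∂tau
      = (1 - lam * ∫ s, s ∂G) / lam * (1 / laplace G lam - 1) := by
  have := hG.isProbabilityMeasure
  have h := laplace_stationary_self hlam hG htau
  rw [laplace_steady_rate hlam hG htau] at h
  have hpos := laplace_pos hG.nonneg hlam.le
  generalize ∫ t, t * Real.exp (-(lam * t)) ∂tau = J at h ⊢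
  field_simp
  linear_combination -h

end

/-! ### Moments of the inter-departure time -/

lemma interDeparture_eq (p : ℝ × ℝ × ℝ) : interDeparture p = max (p.2.1 - p.1) 0 + p.2.2 := by
  unfold interDeparture
  split_ifs with h
  · rw [max_eq_right (by linarith), zero_add]
  · rw [max_eq_left (by linarith)]

section

variable {lam : ℝ} {G tau : Measure ℝ}

lemma integral_queueLaw_mul (hlam : 0 < lam) [IsProbabilityMeasure G] [IsProbabilityMeasure tau]
    {F : ℝ → ℝ → ℝ} {g : ℝ → ℝ}
    (hint : Integrable (fun p : ℝ × ℝ × ℝ => F p.1 p.2.1 * g p.2.2) (queueLaw lam G tau)) :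
    ∫ p, F p.1 p.2.1 * g p.2.2 ∂(queueLaw lam G tau)
      = (∫ t, ∫ x, F t x ∂(expMeasure lam) ∂tau) * ∫ s, g s ∂G := by
  have := isProbabilityMeasure_expMeasure hlam
  rw [queueLaw, integral_prod _ hint, ← integral_mul_const]
  congr 1 with t
  rw [← integral_prod_mul]

lemma integral_queueLaw_fst_snd (hlam : 0 < lam) [IsProbabilityMeasure G]
    [IsProbabilityMeasure tau] {F : ℝ → ℝ → ℝ}
    (hint : Integrable (fun p : ℝ × ℝ × ℝ => F p.1 p.2.1) (queueLaw lam G tau)) :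
    ∫ p, F p.1 p.2.1 ∂(queueLaw lam G tau) = ∫ t, ∫ x, F t x ∂(expMeasure lam) ∂tau := by
  have := integral_queueLaw_mul (F := F) (g := fun _ => 1) (G := G) (tau := tau) hlam
    (by simpa using hint)
  simpa using this

lemma integrable_queueLaw_service (hlam : 0 < lam) [IsProbabilityMeasure G]
    [IsProbabilityMeasure tau] {g : ℝ → ℝ} (hg : Integrable g G) :
    Integrable (fun p : ℝ × ℝ × ℝ => g p.2.2) (queueLaw lam G tau) := by
  have := isProbabilityMeasure_expMeasure hlam
  exact (hg.comp_snd _).comp_snd _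

lemma integral_queueLaw_service (hlam : 0 < lam) [IsProbabilityMeasure G]
    [IsProbabilityMeasure tau] {g : ℝ → ℝ} (hg : Integrable g G) :
    ∫ p, g p.2.2 ∂(queueLaw lam G tau) = ∫ s, g s ∂G := by
  have := isProbabilityMeasure_expMeasure hlam
  have := integral_queueLaw_mul (F := fun _ _ => 1) (g := g) (G := G) (tau := tau) hlam
    (by simpa using integrable_queueLaw_service hlam hg)
  simpa using this

lemma integrable_queueLaw_arrival (hlam : 0 < lam) [IsProbabilityMeasure G]
    [IsProbabilityMeasure tau] {g : ℝ → ℝ} (hg : Integrable g (expMeasure lam)) :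
    Integrable (fun p : ℝ × ℝ × ℝ => g p.2.1) (queueLaw lam G tau) := by
  have := isProbabilityMeasure_expMeasure hlam
  exact (hg.comp_fst G).comp_snd tau

lemma posPart_sub_le {t x : ℝ} (ht : 0 ≤ t) (hx : 0 ≤ x) : max (x - t) 0 ≤ x :=
  max_le (by linarith) hx

lemma integrable_idle (hlam : 0 < lam) (hG : IsServiceLaw G)
    (htau : IsSteadySystemTime lam G tau) :
    Integrable (fun p : ℝ × ℝ × ℝ => max (p.2.1 - p.1) 0) (queueLaw lam G tau) := by
  have := hG.isProbabilityMeasure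
  have := htau.isProbabilityMeasure
  refine Integrable.mono' (integrable_queueLaw_arrival hlam (integrable_id_expMeasure hlam))
    (by fun_prop) ?_
  filter_upwards [queueLaw_ae_nonneg hlam hG.nonneg htau.nonneg] with p hp
  rw [Real.norm_eq_abs, abs_of_nonneg (le_max_right _ _)]
  exact posPart_sub_le hp.1 hp.2.1.le

lemma integrable_idle_sq (hlam : 0 < lam) (hG : IsServiceLaw G)
    (htau : IsSteadySystemTime lam G tau) :
    Integrable (fun p : ℝ × ℝ × ℝ => max (p.2.1 - p.1) 0 ^ 2) (queueLaw lam G tau) := by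
  have := hG.isProbabilityMeasure
  have := htau.isProbabilityMeasure
  refine Integrable.mono' (integrable_queueLaw_arrival hlam (integrable_pow_expMeasure hlam 2))
    (by fun_prop) ?_
  filter_upwards [queueLaw_ae_nonneg hlam hG.nonneg htau.nonneg] with p hp
  rw [Real.norm_eq_abs, abs_of_nonneg (by positivity)]
  exact pow_le_pow_left₀ (le_max_right _ _) (posPart_sub_le hp.1 hp.2.1.le) 2

lemma integrable_systemTime_mul_idle (hlam : 0 < lam) (hG : IsServiceLaw G)
    (htau : IsSteadySystemTime lam G tau) (hT : Integrable (fun t => t) tau) :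
    Integrable (fun p : ℝ × ℝ × ℝ => p.1 * max (p.2.1 - p.1) 0) (queueLaw lam G tau) := by
  have := isProbabilityMeasure_expMeasure hlam
  have := hG.isProbabilityMeasure
  have := htau.isProbabilityMeasure
  have h : Integrable (fun p : ℝ × ℝ × ℝ => p.1 * p.2.1) (queueLaw lam G tau) :=
    hT.mul_prod ((integrable_id_expMeasure hlam).comp_fst G)
  refine Integrable.mono' h (by fun_prop) ?_
  filter_upwards [queueLaw_ae_nonneg hlam hG.nonneg htau.nonneg] with p hp
  rw [Real.norm_eq_abs, abs_of_nonneg (mul_nonneg hp.1 (le_max_right _ _))]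
  exact mul_le_mul_of_nonneg_left (posPart_sub_le hp.1 hp.2.1.le) hp.1

lemma integrable_systemTime_mul_service (hlam : 0 < lam) (hG : IsServiceLaw G)
    (htau : IsSteadySystemTime lam G tau) (hT : Integrable (fun t => t) tau) :
    Integrable (fun p : ℝ × ℝ × ℝ => p.1 * p.2.2) (queueLaw lam G tau) := by
  have := isProbabilityMeasure_expMeasure hlam
  have := hG.isProbabilityMeasure
  have := htau.isProbabilityMeasure
  exact hT.mul_prod (hG.integrable.comp_snd (expMeasure lam))

lemma integrable_idle_mul_service (hlam : 0 < lam) (hG : IsServiceLaw G)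
    (htau : IsSteadySystemTime lam G tau) :
    Integrable (fun p : ℝ × ℝ × ℝ => max (p.2.1 - p.1) 0 * p.2.2) (queueLaw lam G tau) := by
  have := isProbabilityMeasure_expMeasure hlam
  have := hG.isProbabilityMeasure
  have := htau.isProbabilityMeasure
  have h : Integrable (fun p : ℝ × ℝ × ℝ => p.2.1 * p.2.2) (queueLaw lam G tau) :=
    ((integrable_id_expMeasure hlam).mul_prod hG.integrable).comp_snd tau
  refine Integrable.mono' h (by fun_prop) ?_
  filter_upwards [queueLaw_ae_nonneg hlam hG.nonneg htau.nonneg] with p hp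
  rw [Real.norm_eq_abs, abs_of_nonneg (mul_nonneg (le_max_right _ _) hp.2.2)]
  exact mul_le_mul_of_nonneg_right (posPart_sub_le hp.1 hp.2.1.le) hp.2.2

lemma integral_idle (hlam : 0 < lam) (hG : IsServiceLaw G)
    (htau : IsSteadySystemTime lam G tau) :
    ∫ p, max (p.2.1 - p.1) 0 ∂(queueLaw lam G tau) = laplace tau lam / lam := by
  have := hG.isProbabilityMeasure
  have := htau.isProbabilityMeasure
  rw [integral_queueLaw_fst_snd (F := fun t x => max (x - t) 0) hlam
      (integrable_idle hlam hG htau), laplace, ← integral_div]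
  refine integral_congr_ae ?_
  filter_upwards [htau.nonneg] with t ht using integral_posPart_expMeasure hlam ht

lemma integral_idle_sq (hlam : 0 < lam) (hG : IsServiceLaw G)
    (htau : IsSteadySystemTime lam G tau) :
    ∫ p, max (p.2.1 - p.1) 0 ^ 2 ∂(queueLaw lam G tau) = 2 * laplace tau lam / lam ^ 2 := by
  have := hG.isProbabilityMeasure
  have := htau.isProbabilityMeasure
  rw [integral_queueLaw_fst_snd (F := fun t x => max (x - t) 0 ^ 2) hlam
      (integrable_idle_sq hlam hG htau), laplace, ← integral_const_mul, ← integral_div]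
  refine integral_congr_ae ?_
  filter_upwards [htau.nonneg] with t ht using integral_posPart_sq_expMeasure hlam ht

lemma integral_systemTime_mul_idle (hlam : 0 < lam) (hG : IsServiceLaw G)
    (htau : IsSteadySystemTime lam G tau) (hT : Integrable (fun t => t) tau) :
    ∫ p, p.1 * max (p.2.1 - p.1) 0 ∂(queueLaw lam G tau)
      = (∫ t, t * Real.exp (-(lam * t)) ∂tau) / lam := by
  have := hG.isProbabilityMeasure
  have := htau.isProbabilityMeasure
  rw [integral_queueLaw_fst_snd (F := fun t x => t * max (x - t) 0) hlam
      (integrable_systemTime_mul_idle hlam hG htau hT), ← integral_div]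
  refine integral_congr_ae ?_
  filter_upwards [htau.nonneg] with t ht
  rw [integral_const_mul, integral_posPart_expMeasure hlam ht, mul_div_assoc]

lemma integral_systemTime_mul_service (hlam : 0 < lam) (hG : IsServiceLaw G)
    (htau : IsSteadySystemTime lam G tau) (hT : Integrable (fun t => t) tau) :
    ∫ p, p.1 * p.2.2 ∂(queueLaw lam G tau) = (∫ t, t ∂tau) * ∫ s, s ∂G := by
  have := isProbabilityMeasure_expMeasure hlam
  have := hG.isProbabilityMeasure
  have := htau.isProbabilityMeasure
  rw [integral_queueLaw_mul (F := fun t _ => t) (g := fun s => s) hlam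
      (integrable_systemTime_mul_service hlam hG htau hT)]
  simp

lemma integral_idle_mul_service (hlam : 0 < lam) (hG : IsServiceLaw G)
    (htau : IsSteadySystemTime lam G tau) :
    ∫ p, max (p.2.1 - p.1) 0 * p.2.2 ∂(queueLaw lam G tau)
      = laplace tau lam / lam * ∫ s, s ∂G := by
  have := hG.isProbabilityMeasure
  have := htau.isProbabilityMeasure
  rw [integral_queueLaw_mul (F := fun t x => max (x - t) 0) (g := fun s => s) hlam
      (integrable_idle_mul_service hlam hG htau), laplace, ← integral_div]
  congr 1
  refine integral_congr_ae ?_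
  filter_upwards [htau.nonneg] with t ht using integral_posPart_expMeasure hlam ht

lemma integrable_interDeparture (hlam : 0 < lam) (hG : IsServiceLaw G)
    (htau : IsSteadySystemTime lam G tau) :
    Integrable interDeparture (queueLaw lam G tau) := by
  have := hG.isProbabilityMeasure
  have := htau.isProbabilityMeasure
  refine ((integrable_idle hlam hG htau).add
    (integrable_queueLaw_service hlam hG.integrable)).congr (ae_of_all _ fun p => ?_)
  simp [interDeparture_eq]

/-- In steady state departures occur at the arrival rate. -/
lemma integral_interDeparture (hlam : 0 < lam) (hG : IsServiceLaw G)
    (htau : IsSteadySystemTime lam G tau) :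
    ∫ p, interDeparture p ∂(queueLaw lam G tau) = 1 / lam := by
  have := hG.isProbabilityMeasure
  have := htau.isProbabilityMeasure
  simp only [interDeparture_eq]
  rw [integral_add (integrable_idle hlam hG htau) (integrable_queueLaw_service hlam hG.integrable),
    integral_idle hlam hG htau, integral_queueLaw_service hlam hG.integrable,
    laplace_steady_rate hlam hG htau]
  field_simp
  ring

lemma age_integral_split (p : ℝ × ℝ × ℝ) :
    p.1 * interDeparture p + interDeparture p ^ 2 / 2
      = p.1 * max (p.2.1 - p.1) 0 + p.1 * p.2.2 + max (p.2.1 - p.1) 0 ^ 2 / 2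
        + max (p.2.1 - p.1) 0 * p.2.2 + p.2.2 ^ 2 / 2 := by
  rw [interDeparture_eq]
  ring

lemma integrable_age_integral (hlam : 0 < lam) (hG : IsServiceLaw G)
    (htau : IsSteadySystemTime lam G tau) (hT : Integrable (fun t => t) tau) :
    Integrable (fun p => p.1 * interDeparture p + interDeparture p ^ 2 / 2)
      (queueLaw lam G tau) := by
  have := hG.isProbabilityMeasure
  have := htau.isProbabilityMeasure
  simp only [age_integral_split]
  exact ((((integrable_systemTime_mul_idle hlam hG htau hT).add
    (integrable_systemTime_mul_service hlam hG htau hT)).add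
    ((integrable_idle_sq hlam hG htau).div_const 2)).add
    (integrable_idle_mul_service hlam hG htau)).add
    ((integrable_queueLaw_service hlam hG.integrable_sq).div_const 2)

/-- The mean integral of the age over an inter-departure time. -/
lemma integral_age_integral (hlam : 0 < lam) (hG : IsServiceLaw G)
    (htau : IsSteadySystemTime lam G tau) (hT : Integrable (fun t => t) tau) :
    ∫ p, (p.1 * interDeparture p + interDeparture p ^ 2 / 2) ∂(queueLaw lam G tau)
      = (∫ t, t * Real.exp (-(lam * t)) ∂tau) / lam + (∫ t, t ∂tau) * ∫ s, s ∂G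
        + laplace tau lam / lam ^ 2 + laplace tau lam / lam * (∫ s, s ∂G)
        + (∫ s, s ^ 2 ∂G) / 2 := by
  have := hG.isProbabilityMeasure
  have := htau.isProbabilityMeasure
  have i1 := integrable_systemTime_mul_idle hlam hG htau hT
  have i2 := integrable_systemTime_mul_service hlam hG htau hT
  have i3 := (integrable_idle_sq hlam hG htau).div_const 2
  have i4 := integrable_idle_mul_service hlam hG htau
  have i5 := (integrable_queueLaw_service (tau := tau) hlam hG.integrable_sq).div_const 2
  have e2 := integral_add (i1.add i2) i3
  have e3 := integral_add ((i1.add i2).add i3) i4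
  have e4 := integral_add (((i1.add i2).add i3).add i4) i5
  simp only [Pi.add_apply] at e2 e3 e4
  simp only [age_integral_split]
  rw [e4, e3, e2, integral_add i1 i2, integral_div, integral_div,
    integral_systemTime_mul_idle hlam hG htau hT, integral_systemTime_mul_service hlam hG htau hT,
    integral_idle_sq hlam hG htau, integral_idle_mul_service hlam hG htau,
    integral_queueLaw_service hlam hG.integrable_sq]
  ring

/-! ### Poisson decisions -/

/-- The Erlang densities are `ν e^{-νx} (νx)^j / j!`, so the exponential series cancels the decay
and leaves a constant intensity. -/
lemma tsum_gammaPDF {nu : ℝ} (hnu : 0 < nu) (x : ℝ) :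
    ∑' j : ℕ, gammaPDF ((j : ℝ) + 1) nu x
      = (Set.Ici 0).indicator (fun _ => ENNReal.ofReal nu) x := by
  rcases lt_or_ge x 0 with hx | hx
  · simp [gammaPDF_of_neg hx, hx]
  · rw [Set.indicator_of_mem (Set.mem_Ici.2 hx)]
    have hs : HasSum (fun j : ℕ => nu * Real.exp (-(nu * x)) * ((nu * x) ^ j / j.factorial))
        (nu * Real.exp (-(nu * x)) * Real.exp (nu * x)) := by
      have := NormedSpace.expSeries_div_hasSum_exp (nu * x)
      rw [← Real.exp_eq_exp_ℝ] at this
      exact this.mul_left _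
    rw [mul_assoc, ← Real.exp_add, neg_add_cancel, Real.exp_zero, mul_one] at hs
    conv_rhs =>
      rw [← hs.tsum_eq, ENNReal.ofReal_tsum_of_nonneg (fun j => by positivity) hs.summable]
    congr 1 with j
    rw [gammaPDF_of_nonneg hx, add_sub_cancel_right, Real.Gamma_nat_eq_factorial,
      Real.rpow_natCast, show (j : ℝ) + 1 = ((j + 1 : ℕ) : ℝ) by push_cast; ring,
      Real.rpow_natCast]
    congr 1
    rw [mul_pow, pow_succ]
    ring

lemma poissonEpochs_eq {nu : ℝ} (hnu : 0 < nu) :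
    poissonEpochs nu = ENNReal.ofReal nu • volume.restrict (Set.Ici 0) := by
  unfold poissonEpochs gammaMeasure
  rw [← withDensity_tsum (f := fun j : ℕ => gammaPDF ((j : ℝ) + 1) nu)
    (fun j => (measurable_gammaPDFReal _ _).ennreal_ofReal)]
  have : (∑' j : ℕ, gammaPDF ((j : ℝ) + 1) nu)
      = (Set.Ici 0).indicator (fun _ => ENNReal.ofReal nu) := by
    ext x
    rw [tsum_apply (Pi.summable.2 fun _ => ENNReal.summable), tsum_gammaPDF hnu]
  rw [this, withDensity_indicator measurableSet_Ici, withDensity_const]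

lemma poissonEpochs_restrict_Ioc {nu : ℝ} (hnu : 0 < nu) (y : ℝ) :
    (poissonEpochs nu).restrict (Set.Ioc 0 y)
      = ENNReal.ofReal nu • volume.restrict (Set.Ioc 0 y) := by
  rw [poissonEpochs_eq hnu, Measure.restrict_smul, Measure.restrict_restrict measurableSet_Ioc,
    Set.inter_eq_left.2 (fun x hx => hx.1.le)]

lemma poissonEpochs_real_Ioc {nu : ℝ} (hnu : 0 < nu) {y : ℝ} (hy : 0 ≤ y) :
    (poissonEpochs nu).real (Set.Ioc 0 y) = nu * y := by
  rw [Measure.real, ← Measure.restrict_apply_univ, poissonEpochs_restrict_Ioc hnu]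
  simp [hnu.le, hy]

lemma integral_poissonEpochs_Ioc {nu : ℝ} (hnu : 0 < nu) (t : ℝ) {y : ℝ} (hy : 0 ≤ y) :
    ∫ u in Set.Ioc 0 y, (t + u) ∂(poissonEpochs nu) = nu * (t * y + y ^ 2 / 2) := by
  rw [poissonEpochs_restrict_Ioc hnu, integral_smul_measure, ← intervalIntegral.integral_of_le hy,
    intervalIntegral.integral_add (by simp) (by simp)]
  simp [hnu.le]
  left
  ring

lemma interDeparture_ae_nonneg (hlam : 0 < lam) (hG : IsServiceLaw G)
    (htau : IsSteadySystemTime lam G tau) :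
    ∀ᵐ p ∂(queueLaw lam G tau), 0 ≤ interDeparture p := by
  have := hG.isProbabilityMeasure
  have := htau.isProbabilityMeasure
  filter_upwards [queueLaw_ae_nonneg hlam hG.nonneg htau.nonneg] with p hp
  rw [interDeparture_eq]
  exact add_nonneg (le_max_right _ _) hp.2.2

/-- The average age upon Poisson decisions is the time average of the age. -/
lemma poissonAuD_eq (hlam : 0 < lam) (hG : IsServiceLaw G)
    (htau : IsSteadySystemTime lam G tau) {nu : ℝ} (hnu : 0 < nu) :
    poissonAuD lam nu G tau
      = lam * ∫ p, (p.1 * interDeparture p + interDeparture p ^ 2 / 2) ∂(queueLaw lam G tau) := by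
  have h0 := interDeparture_ae_nonneg hlam hG htau
  have hn : ∫ p, ∫ u in Set.Ioc 0 (interDeparture p), (p.1 + u) ∂(poissonEpochs nu)
        ∂(queueLaw lam G tau)
      = nu * ∫ p, (p.1 * interDeparture p + interDeparture p ^ 2 / 2) ∂(queueLaw lam G tau) := by
    rw [← integral_const_mul]
    refine integral_congr_ae ?_
    filter_upwards [h0] with p hp using integral_poissonEpochs_Ioc hnu p.1 hp
  have hd : ∫ p, (poissonEpochs nu).real (Set.Ioc 0 (interDeparture p)) ∂(queueLaw lam G tau)
      = nu / lam := by
    rw [div_eq_mul_one_div, ← integral_interDeparture hlam hG htau, ← integral_const_mul]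
    refine integral_congr_ae ?_
    filter_upwards [h0] with p hp using poissonEpochs_real_Ioc hnu hp
  rw [poissonAuD, hn, hd, div_div_eq_mul_div, mul_comm nu, mul_assoc, mul_comm nu, ← mul_assoc,
    mul_div_cancel_right₀ _ hnu.ne', mul_comm]

/-- The average age upon Poisson decisions in terms of the first two moments and the Laplace
transform of the service time. -/
lemma poissonAuD_closed_form (hlam : 0 < lam) (hG : IsServiceLaw G)
    (htau : IsSteadySystemTime lam G tau) (hrho : lam * ∫ s, s ∂G < 1) {nu : ℝ} (hnu : 0 < nu) :
    poissonAuD lam nu G tau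
      = (1 - lam * ∫ s, s ∂G) / (lam * laplace G lam) + ∫ s, s ∂G
        + lam * (∫ s, s ^ 2 ∂G) / (2 * (1 - lam * ∫ s, s ∂G)) := by
  have := hG.isProbabilityMeasure
  have hT := integrable_steady hlam hG htau hrho
  rw [poissonAuD_eq hlam hG htau hnu, integral_age_integral hlam hG htau hT,
    integral_mul_exp_steady hlam hG htau, integral_steady hlam hG htau hrho,
    laplace_steady_rate hlam hG htau]
  have h1 : 1 - lam * ∫ s, s ∂G ≠ 0 := by linarith
  have h2 := (laplace_pos hG.nonneg hlam.le).ne'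
  generalize ∫ s, s ∂G = m at h1 ⊢
  generalize ∫ s, s ^ 2 ∂G = q
  field_simp
  ring

end

/-! ### Counting periodic decisions with a uniform phase -/

lemma decisionCount_eq_floor {nu : ℝ} (hnu : 0 < nu) (a y : ℝ) :
    decisionCount nu a y = ⌊nu * (y - a) + 1⌋₊ := by
  have : {i : ℕ | a + (i : ℝ) / nu ≤ y} = ((Finset.range ⌊nu * (y - a) + 1⌋₊ : Finset ℕ) : Set ℕ) := by
    ext i
    have h : a + (i : ℝ) / nu ≤ y ↔ (i : ℝ) + 1 ≤ nu * (y - a) + 1 := by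
      rw [← le_sub_iff_add_le', div_le_iff₀ hnu, mul_comm, add_le_add_iff_right]
    simp only [Set.mem_ofPred_eq, Finset.coe_range, Set.mem_Iio]
    -- The `+ 1` in the floor accounts for the epoch with `i = 0`. As `i + 1 ≠ 0`, no sign condition
    -- is needed: the natural floor is 0 when the phase exceeds `y`.
    rw [h, ← Nat.add_one_le_iff, Nat.le_floor_iff' (Nat.succ_ne_zero i)]
    push_cast
    rfl
  rw [decisionCount, this, Set.ncard_coe_finset, Finset.card_range]

/-- The variance `f (1 - f)` of the number of points of a unit lattice with uniform phase in an
interval of length `z`, where `f` is the fractional part of `z`. -/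
noncomputable def latticeVariance (z : ℝ) : ℝ := Int.fract z * (1 - Int.fract z)

lemma latticeVariance_nonneg (z : ℝ) : 0 ≤ latticeVariance z :=
  mul_nonneg (Int.fract_nonneg z) (sub_nonneg.2 (Int.fract_lt_one z).le)

lemma latticeVariance_le_one (z : ℝ) : latticeVariance z ≤ 1 := by
  have := Int.fract_nonneg z
  have := Int.fract_lt_one z
  unfold latticeVariance
  nlinarith

@[simp] lemma latticeVariance_zero : latticeVariance 0 = 0 := by simp [latticeVariance]

lemma measurable_latticeVariance : Measurable latticeVariance :=
  measurable_fract.mul (measurable_const.sub measurable_fract)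

/-- The law of one phase. -/
noncomputable abbrev uniformPhase (nu : ℝ) : Measure ℝ :=
  ProbabilityTheory.cond volume (Set.Ioo 0 (1 / nu))

lemma isProbabilityMeasure_uniformPhase {nu : ℝ} (hnu : 0 < nu) :
    IsProbabilityMeasure (uniformPhase nu) := by
  apply ProbabilityTheory.cond_isProbabilityMeasure_of_finite
  · simpa using hnu
  · simp

lemma uniformPhase_ae (nu : ℝ) : ∀ᵐ a ∂(uniformPhase nu), a ∈ Set.Ioo 0 (1 / nu) :=
  ProbabilityTheory.ae_cond_mem measurableSet_Ioo

lemma uniformPhase_real_Iic {nu f : ℝ} (hnu : 0 < nu) (hf0 : 0 ≤ f) (hf1 : f < 1) :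
    (uniformPhase nu).real (Set.Iic (f / nu)) = f := by
  have hlt : f / nu < 1 / nu := div_lt_div_of_pos_right hf1 hnu
  have hset : Set.Ioo 0 (1 / nu) ∩ Set.Iic (f / nu) = Set.Ioc 0 (f / nu) := by
    ext x
    simp only [Set.mem_inter_iff, Set.mem_Ioo, Set.mem_Iic, Set.mem_Ioc]
    constructor
    · rintro ⟨⟨h1, _⟩, h3⟩
      exact ⟨h1, h3⟩
    · rintro ⟨h1, h3⟩
      exact ⟨⟨h1, by linarith⟩, h3⟩
  rw [Measure.real, ProbabilityTheory.cond_apply measurableSet_Ioo, hset, Real.volume_Ioo,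
    Real.volume_Ioc, ENNReal.toReal_mul, ENNReal.toReal_inv, sub_zero, sub_zero,
    ENNReal.toReal_ofReal (by positivity), ENNReal.toReal_ofReal (by positivity)]
  field_simp

/-- Every full period contains one epoch, and the leftover piece contains another exactly when the
phase fits into it. Under a uniform phase the extra point is Bernoulli with the fractional part as
parameter. -/
lemma decisionCount_eq_indicator {nu a y : ℝ} (hnu : 0 < nu) (ha : a ∈ Set.Ioo 0 (1 / nu))
    (hy : 0 ≤ y) :
    (decisionCount nu a y : ℝ)
      = ⌊nu * y⌋ + (Set.Iic (Int.fract (nu * y) / nu)).indicator (fun _ => (1 : ℝ)) a := by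
  rw [decisionCount_eq_floor hnu]
  have ha1 : nu * a < 1 := by
    have := (lt_div_iff₀ hnu).1 ha.2
    linarith
  have ha0 : 0 < nu * a := mul_pos hnu ha.1
  have hy' : 0 ≤ nu * y := by positivity
  have hcast : ((⌊nu * (y - a) + 1⌋₊ : ℕ) : ℝ) = ((⌊nu * (y - a) + 1⌋ : ℤ) : ℝ) := by
    rw [← Int.natCast_floor_eq_floor (by nlinarith)]
    simp
  have hfr := Int.floor_add_fract (nu * y)
  have hf0 := Int.fract_nonneg (nu * y)
  have hf1 := Int.fract_lt_one (nu * y)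
  rw [hcast]
  by_cases h : a ≤ Int.fract (nu * y) / nu
  · have h' := (le_div_iff₀ hnu).1 h
    rw [Set.indicator_of_mem (Set.mem_Iic.2 h)]
    have : ⌊nu * (y - a) + 1⌋ = ⌊nu * y⌋ + 1 := by
      rw [Int.floor_eq_iff]
      push_cast
      constructor <;> nlinarith
    rw [this]
    push_cast
    rfl
  · have h' := (div_lt_iff₀ hnu).1 (not_le.1 h)
    rw [Set.indicator_of_notMem (by simpa using h), add_zero]
    have : ⌊nu * (y - a) + 1⌋ = ⌊nu * y⌋ := by
      rw [Int.floor_eq_iff]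
      constructor <;> nlinarith
    rw [this]

lemma decisionCount_le {nu a y : ℝ} (hnu : 0 < nu) (ha : a ∈ Set.Ioo 0 (1 / nu)) (hy : 0 ≤ y) :
    (decisionCount nu a y : ℝ) ≤ nu * y + 1 := by
  rw [decisionCount_eq_indicator hnu ha hy]
  refine add_le_add (Int.floor_le _) ?_
  exact Set.indicator_apply_le' (fun _ => le_rfl) (fun _ => zero_le_one)

lemma Measurable.decisionCount {α : Type*} [MeasurableSpace α] {nu : ℝ} (hnu : 0 < nu)
    {a y : α → ℝ} (ha : Measurable a) (hy : Measurable y) :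
    Measurable (fun q => decisionCount nu (a q) (y q)) := by
  simp only [decisionCount_eq_floor hnu]
  exact Nat.measurable_floor.comp (by fun_prop)

lemma integrable_decisionCount {nu y : ℝ} (hnu : 0 < nu) (hy : 0 ≤ y) (n : ℕ) :
    Integrable (fun a => (decisionCount nu a y : ℝ) ^ n) (uniformPhase nu) := by
  have := isProbabilityMeasure_uniformPhase hnu
  have hm : Measurable (fun a => decisionCount nu a y) :=
    Measurable.decisionCount hnu measurable_id measurable_const
  refine Integrable.mono' (integrable_const ((nu * y + 1) ^ n)) (by fun_prop) ?_
  filter_upwards [uniformPhase_ae nu] with a ha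
  rw [Real.norm_eq_abs, abs_of_nonneg (by positivity)]
  exact pow_le_pow_left₀ (by positivity) (decisionCount_le hnu ha hy) n

lemma integral_decisionCount {nu y : ℝ} (hnu : 0 < nu) (hy : 0 ≤ y) :
    ∫ a, (decisionCount nu a y : ℝ) ∂(uniformPhase nu) = nu * y := by
  have := isProbabilityMeasure_uniformPhase hnu
  rw [integral_congr_ae ((uniformPhase_ae nu).mono fun a ha =>
      decisionCount_eq_indicator hnu ha hy), integral_add (integrable_const _)
      ((integrable_const _).indicator measurableSet_Iic), integral_indicator_const _
      measurableSet_Iic, uniformPhase_real_Iic hnu (Int.fract_nonneg _) (Int.fract_lt_one _)]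
  simp [Int.floor_add_fract]

lemma integral_decisionCount_sq {nu y : ℝ} (hnu : 0 < nu) (hy : 0 ≤ y) :
    ∫ a, (decisionCount nu a y : ℝ) ^ 2 ∂(uniformPhase nu)
      = (nu * y) ^ 2 + latticeVariance (nu * y) := by
  have := isProbabilityMeasure_uniformPhase hnu
  have h : ∀ᵐ a ∂(uniformPhase nu), (decisionCount nu a y : ℝ) ^ 2
      = (⌊nu * y⌋ : ℝ) ^ 2
        + (Set.Iic (Int.fract (nu * y) / nu)).indicator (fun _ => 2 * (⌊nu * y⌋ : ℝ) + 1) a := by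
    filter_upwards [uniformPhase_ae nu] with a ha
    rw [decisionCount_eq_indicator hnu ha hy]
    by_cases hmem : a ∈ Set.Iic (Int.fract (nu * y) / nu)
    · rw [Set.indicator_of_mem hmem, Set.indicator_of_mem hmem]
      ring
    · rw [Set.indicator_of_notMem hmem, Set.indicator_of_notMem hmem]
      ring
  rw [integral_congr_ae h, integral_add (integrable_const _)
      ((integrable_const _).indicator measurableSet_Iic), integral_indicator_const _
      measurableSet_Iic, uniformPhase_real_Iic hnu (Int.fract_nonneg _) (Int.fract_lt_one _)]
  have hfr := Int.floor_add_fract (nu * y)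
  simp only [integral_const, probReal_univ, smul_eq_mul, latticeVariance]
  -- Only the bare `nu * y` in the square is to be split; the earlier occurrences are inside floors
  -- and fractional parts.
  nth_rewrite 4 [← hfr]
  ring

/-! ### Periodic decisions in an inter-departure time -/

lemma decisionCount_zero {nu a : ℝ} (hnu : 0 < nu) (ha : 0 < a) : decisionCount nu a 0 = 0 := by
  rw [decisionCount_eq_floor hnu, Nat.floor_eq_zero]
  nlinarith

/-- A positive phase leaves no epoch in an interval of length zero, so the busy case is an idle
period of length zero and the case distinction disappears. -/
lemma periodicCount_eq {nu : ℝ} (hnu : 0 < nu) (p : ℝ × ℝ × ℝ) {c : ℝ × ℝ} (hc : 0 < c.1) :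
    periodicCount nu p c
      = decisionCount nu c.1 (max (p.2.1 - p.1) 0) + decisionCount nu c.2 p.2.2 := by
  unfold periodicCount
  split_ifs with h
  · rw [max_eq_right (by linarith), decisionCount_zero hnu hc]
  · rw [max_eq_left (by linarith)]

/-- The offset of half a step removes the term linear in `n * d`, so the excess age depends on the
count only through its second moment. -/
lemma sum_range_arith (a d : ℝ) (n : ℕ) :
    ∑ j ∈ Finset.range n, (a + d / 2 + (j : ℝ) * d) = n * a + n ^ 2 * d / 2 := by
  induction n with
  | zero => simp
  | succ k ih =>
    rw [Finset.sum_range_succ, ih]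
    push_cast
    ring

lemma periodicAgeSum_eq (nu : ℝ) (p : ℝ × ℝ × ℝ) (c : ℝ × ℝ) :
    periodicAgeSum nu p c
      = (periodicCount nu p c : ℝ) * p.1 + (periodicCount nu p c : ℝ) ^ 2 / (2 * nu) := by
  have h := sum_range_arith p.1 (1 / nu) (periodicCount nu p c)
  rw [periodicAgeSum]
  convert h using 2
  · ring
  · ring

lemma phaseLaw_eq (nu : ℝ) : phaseLaw nu = (uniformPhase nu).prod (uniformPhase nu) := rfl

lemma phaseLaw_ae {nu : ℝ} (hnu : 0 < nu) :
    ∀ᵐ c ∂(phaseLaw nu), c.1 ∈ Set.Ioo 0 (1 / nu) ∧ c.2 ∈ Set.Ioo 0 (1 / nu) := by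
  have := isProbabilityMeasure_uniformPhase hnu
  have h1 : ∀ᵐ c ∂(phaseLaw nu), c.1 ∈ Set.Ioo 0 (1 / nu) :=
    Measure.quasiMeasurePreserving_fst.ae (uniformPhase_ae nu)
  have h2 : ∀ᵐ c ∂(phaseLaw nu), c.2 ∈ Set.Ioo 0 (1 / nu) :=
    Measure.quasiMeasurePreserving_snd.ae (uniformPhase_ae nu)
  exact h1.and h2

lemma measurable_periodicCount {nu : ℝ} (hnu : 0 < nu) :
    Measurable (fun q : (ℝ × ℝ × ℝ) × (ℝ × ℝ) => periodicCount nu q.1 q.2) := by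
  unfold periodicCount
  refine Measurable.add (Measurable.ite ?_ measurable_const ?_) ?_
  · exact measurableSet_le (by fun_prop) (by fun_prop)
  · exact Measurable.decisionCount hnu (by fun_prop) (by fun_prop)
  · exact Measurable.decisionCount hnu (by fun_prop) (by fun_prop)

section

variable {nu : ℝ} {p : ℝ × ℝ × ℝ}

lemma integral_periodicCount (hnu : 0 < nu) (hs : 0 ≤ p.2.2) :
    ∫ c, (periodicCount nu p c : ℝ) ∂(phaseLaw nu) = nu * interDeparture p := by
  have := isProbabilityMeasure_uniformPhase hnu
  have hz : 0 ≤ max (p.2.1 - p.1) 0 := le_max_right _ _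
  have i1 := integrable_decisionCount hnu hz 1
  have i2 := integrable_decisionCount hnu hs 1
  simp only [pow_one] at i1 i2
  rw [integral_congr_ae ((phaseLaw_ae hnu).mono fun c hc => by
      simp only [periodicCount_eq hnu p hc.1.1, Nat.cast_add]; rfl), phaseLaw_eq]
  have h := integral_add (i1.comp_fst (uniformPhase nu)) (i2.comp_snd (uniformPhase nu))
  rw [h, integral_fun_fst (fun a => (decisionCount nu a (max (p.2.1 - p.1) 0) : ℝ)),
    integral_fun_snd (fun a => (decisionCount nu a p.2.2 : ℝ)), integral_decisionCount hnu hz,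
    integral_decisionCount hnu hs, interDeparture_eq]
  simp
  ring

/-- The phases are independent, so the cross term is a product of means and the two lattice
variances add. -/
lemma integral_periodicCount_sq (hnu : 0 < nu) (hs : 0 ≤ p.2.2) :
    ∫ c, (periodicCount nu p c : ℝ) ^ 2 ∂(phaseLaw nu)
      = (nu * interDeparture p) ^ 2 + latticeVariance (nu * max (p.2.1 - p.1) 0)
        + latticeVariance (nu * p.2.2) := by
  have := isProbabilityMeasure_uniformPhase hnu
  have hz : 0 ≤ max (p.2.1 - p.1) 0 := le_max_right _ _
  set N2 : ℝ → ℝ := fun a => (decisionCount nu a (max (p.2.1 - p.1) 0) : ℝ) with hN2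
  set N3 : ℝ → ℝ := fun a => (decisionCount nu a p.2.2 : ℝ) with hN3
  have i1 : Integrable N2 (uniformPhase nu) := by simpa using integrable_decisionCount hnu hz 1
  have i2 : Integrable N3 (uniformPhase nu) := by simpa using integrable_decisionCount hnu hs 1
  have i3 : Integrable (fun a => N2 a ^ 2) (uniformPhase nu) := integrable_decisionCount hnu hz 2
  have i4 : Integrable (fun a => N3 a ^ 2) (uniformPhase nu) := integrable_decisionCount hnu hs 2
  have heq : ∀ᵐ c ∂(phaseLaw nu), (periodicCount nu p c : ℝ) ^ 2
      = N2 c.1 ^ 2 + N3 c.2 ^ 2 + 2 * (N2 c.1 * N3 c.2) := by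
    filter_upwards [phaseLaw_ae hnu] with c hc
    rw [periodicCount_eq hnu p hc.1.1, Nat.cast_add]
    ring
  have j1 := i3.comp_fst (uniformPhase nu)
  have j2 := i4.comp_snd (uniformPhase nu)
  have j3 := (i1.mul_prod i2).const_mul 2
  have e1 := integral_add j1 j2
  have e2 := integral_add (j1.add j2) j3
  simp only [Pi.add_apply] at e2
  rw [integral_congr_ae heq, phaseLaw_eq, e2, e1, integral_const_mul, integral_prod_mul,
    integral_fun_fst (fun a => N2 a ^ 2), integral_fun_snd (fun a => N3 a ^ 2),
    integral_decisionCount_sq hnu hz, integral_decisionCount_sq hnu hs,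
    integral_decisionCount hnu hz, integral_decisionCount hnu hs, interDeparture_eq]
  simp
  ring

lemma integral_periodicAgeSum (hnu : 0 < nu) (hs : 0 ≤ p.2.2) :
    ∫ c, periodicAgeSum nu p c ∂(phaseLaw nu)
      = nu * (p.1 * interDeparture p + interDeparture p ^ 2 / 2)
        + 1 / (2 * nu) * (latticeVariance (nu * max (p.2.1 - p.1) 0)
          + latticeVariance (nu * p.2.2)) := by
  have := isProbabilityMeasure_uniformPhase hnu
  have hprob : IsProbabilityMeasure (phaseLaw nu) := by rw [phaseLaw_eq]; infer_instance
  have hz : 0 ≤ max (p.2.1 - p.1) 0 := le_max_right _ _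
  have hmeas : Measurable (fun c => periodicCount nu p c) :=
    (measurable_periodicCount hnu).comp measurable_prodMk_left
  have hbound : ∀ᵐ c ∂(phaseLaw nu),
      (periodicCount nu p c : ℝ) ≤ nu * max (p.2.1 - p.1) 0 + 1 + (nu * p.2.2 + 1) := by
    filter_upwards [phaseLaw_ae hnu] with c hc
    rw [periodicCount_eq hnu p hc.1.1, Nat.cast_add]
    exact add_le_add (decisionCount_le hnu hc.1 hz) (decisionCount_le hnu hc.2 hs)
  have hint : ∀ n : ℕ, Integrable (fun c => (periodicCount nu p c : ℝ) ^ n) (phaseLaw nu) := by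
    intro n
    refine Integrable.mono' (integrable_const
      ((nu * max (p.2.1 - p.1) 0 + 1 + (nu * p.2.2 + 1)) ^ n)) (by fun_prop) ?_
    filter_upwards [hbound] with c hc
    rw [Real.norm_eq_abs, abs_of_nonneg (by positivity)]
    exact pow_le_pow_left₀ (by positivity) hc n
  have h1 := hint 1
  simp only [pow_one] at h1
  simp only [periodicAgeSum_eq]
  rw [integral_add (h1.mul_const _) ((hint 2).div_const _), integral_mul_const, integral_div,
    integral_periodicCount hnu hs, integral_periodicCount_sq hnu hs]
  field_simp
  ring

end

/-! ### Periodic average age as the Poisson one plus lattice variances -/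

section

variable {lam nu : ℝ} {G tau : Measure ℝ}

lemma queue_phase_ae (hlam : 0 < lam) (hnu : 0 < nu) (hG : IsServiceLaw G)
    (htau : IsSteadySystemTime lam G tau) :
    ∀ᵐ q ∂((queueLaw lam G tau).prod (phaseLaw nu)), 0 ≤ q.1.1 ∧ 0 ≤ interDeparture q.1 ∧
      (periodicCount nu q.1 q.2 : ℝ) ≤ nu * interDeparture q.1 + 2 := by
  have := isProbabilityMeasure_uniformPhase hnu
  have : IsProbabilityMeasure (phaseLaw nu) := by rw [phaseLaw_eq]; infer_instance
  have := hG.isProbabilityMeasure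
  have := htau.isProbabilityMeasure
  have := isProbabilityMeasure_queueLaw hlam G tau
  have h1 := Measure.quasiMeasurePreserving_fst (μ := queueLaw lam G tau) (ν := phaseLaw nu) |>.ae
    (queueLaw_ae_nonneg hlam hG.nonneg htau.nonneg)
  have h2 := Measure.quasiMeasurePreserving_snd (μ := queueLaw lam G tau) (ν := phaseLaw nu) |>.ae
    (phaseLaw_ae hnu)
  filter_upwards [h1, h2] with q hq hc
  have hz : 0 ≤ max (q.1.2.1 - q.1.1) 0 := le_max_right _ _
  rw [periodicCount_eq hnu q.1 hc.1.1, interDeparture_eq, Nat.cast_add]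
  have a1 := decisionCount_le hnu hc.1 hz
  have a2 := decisionCount_le hnu hc.2 hq.2.2
  exact ⟨hq.1, add_nonneg hz hq.2.2, by linarith⟩

lemma integrable_periodicCount (hlam : 0 < lam) (hnu : 0 < nu) (hG : IsServiceLaw G)
    (htau : IsSteadySystemTime lam G tau) :
    Integrable (fun q => (periodicCount nu q.1 q.2 : ℝ))
      ((queueLaw lam G tau).prod (phaseLaw nu)) := by
  have := isProbabilityMeasure_uniformPhase hnu
  have : IsProbabilityMeasure (phaseLaw nu) := by rw [phaseLaw_eq]; infer_instance
  have := hG.isProbabilityMeasure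
  have := htau.isProbabilityMeasure
  have := isProbabilityMeasure_queueLaw hlam G tau
  have hm := measurable_periodicCount hnu
  refine Integrable.mono' ((((integrable_interDeparture hlam hG htau).const_mul nu).add
    (integrable_const 2)).comp_fst (phaseLaw nu)) (by fun_prop) ?_
  filter_upwards [queue_phase_ae hlam hnu hG htau] with q hq
  rw [Real.norm_eq_abs, abs_of_nonneg (by positivity)]
  exact hq.2.2

lemma integrable_periodicAgeSum (hlam : 0 < lam) (hnu : 0 < nu) (hG : IsServiceLaw G)
    (htau : IsSteadySystemTime lam G tau) (hT : Integrable (fun t => t) tau) :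
    Integrable (fun q => periodicAgeSum nu q.1 q.2)
      ((queueLaw lam G tau).prod (phaseLaw nu)) := by
  have := isProbabilityMeasure_uniformPhase hnu
  have : IsProbabilityMeasure (phaseLaw nu) := by rw [phaseLaw_eq]; infer_instance
  have := hG.isProbabilityMeasure
  have := htau.isProbabilityMeasure
  have := isProbabilityMeasure_expMeasure hlam
  have := isProbabilityMeasure_queueLaw hlam G tau
  have hm := measurable_periodicCount hnu
  -- The dominating function `hb` is the expansion of `(νY + 2) T + (νY + 2)²/(2ν)`, which bounds
  -- the age sum because the count is at most `νY + 2`.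
  have hT' : Integrable (fun p : ℝ × ℝ × ℝ => p.1) (queueLaw lam G tau) := hT.comp_fst _
  have hb := ((((integrable_age_integral hlam hG htau hT).const_mul nu).add
    (hT'.const_mul 2)).add ((integrable_interDeparture hlam hG htau).const_mul 2)).add
    (integrable_const (2 / nu))
  simp only [periodicAgeSum_eq]
  refine Integrable.mono' (hb.comp_fst (phaseLaw nu)) (by fun_prop) ?_
  filter_upwards [queue_phase_ae hlam hnu hG htau] with q hq
  obtain ⟨ht, hy, hN⟩ := hq
  rw [Real.norm_eq_abs, abs_of_nonneg (by positivity)]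
  simp only [Pi.add_apply]
  have h1 : (periodicCount nu q.1 q.2 : ℝ) * q.1.1 ≤ (nu * interDeparture q.1 + 2) * q.1.1 :=
    mul_le_mul_of_nonneg_right hN ht
  have h2 : (periodicCount nu q.1 q.2 : ℝ) ^ 2 / (2 * nu)
      ≤ (nu * interDeparture q.1 + 2) ^ 2 / (2 * nu) :=
    div_le_div_of_nonneg_right (pow_le_pow_left₀ (by positivity) hN 2) (by positivity)
  refine (add_le_add h1 h2).trans (le_of_eq ?_)
  field_simp
  ring

/-- The average age upon periodic decisions exceeds that upon Poisson decisions by the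
contribution of the lattice variances. -/
lemma periodicAuD_eq (hlam : 0 < lam) (hnu : 0 < nu) (hG : IsServiceLaw G)
    (htau : IsSteadySystemTime lam G tau) (hrho : lam * ∫ s, s ∂G < 1) :
    periodicAuD lam nu G tau
      = poissonAuD lam nu G tau + lam / (2 * nu ^ 2) *
        ((1 - lam * ∫ s, s ∂G) * ∫ x, latticeVariance (nu * x) ∂(expMeasure lam)
          + ∫ s, latticeVariance (nu * s) ∂G) := by
  have := isProbabilityMeasure_uniformPhase hnu
  have : IsProbabilityMeasure (phaseLaw nu) := by rw [phaseLaw_eq]; infer_instance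
  have := hG.isProbabilityMeasure
  have := htau.isProbabilityMeasure
  have := isProbabilityMeasure_expMeasure hlam
  have := isProbabilityMeasure_queueLaw hlam G tau
  have hT := integrable_steady hlam hG htau hrho
  have h0 := queueLaw_ae_nonneg hlam hG.nonneg htau.nonneg
  have hbdd : ∀ {α : Type} [MeasurableSpace α] {μ : Measure α} [IsProbabilityMeasure μ]
      {f : α → ℝ}, Measurable f → Integrable (fun x => latticeVariance (nu * f x)) μ := by
    intro α _ μ _ f hf
    refine Integrable.mono' (integrable_const 1)
      (measurable_latticeVariance.comp (hf.const_mul nu)).aestronglyMeasurable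
      (ae_of_all _ fun x => ?_)
    rw [Real.norm_eq_abs, abs_of_nonneg (latticeVariance_nonneg _)]
    exact latticeVariance_le_one _
  have hd : ∫ q, (periodicCount nu q.1 q.2 : ℝ) ∂((queueLaw lam G tau).prod (phaseLaw nu))
      = nu / lam := by
    rw [integral_prod _ (integrable_periodicCount hlam hnu hG htau), div_eq_mul_one_div,
      ← integral_interDeparture hlam hG htau, ← integral_const_mul]
    refine integral_congr_ae ?_
    filter_upwards [h0] with p hp using integral_periodicCount hnu hp.2.2
  have iZ : Integrable (fun p : ℝ × ℝ × ℝ => latticeVariance (nu * max (p.2.1 - p.1) 0))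
      (queueLaw lam G tau) := hbdd (by fun_prop)
  have iS : Integrable (fun p : ℝ × ℝ × ℝ => latticeVariance (nu * p.2.2))
      (queueLaw lam G tau) := hbdd (by fun_prop)
  have hZ : ∫ p, latticeVariance (nu * max (p.2.1 - p.1) 0) ∂(queueLaw lam G tau)
      = laplace tau lam * ∫ x, latticeVariance (nu * x) ∂(expMeasure lam) := by
    rw [integral_queueLaw_fst_snd (F := fun t x => latticeVariance (nu * max (x - t) 0)) hlam iZ,
      laplace, ← integral_mul_const]
    refine integral_congr_ae ?_
    filter_upwards [htau.nonneg] with t ht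
    -- Lack of memory applies because an empty idle period has zero lattice variance. Averaging the
    -- factor `e^{-λt}` over the system time gives `laplace tau lam`.
    rw [integral_expMeasure_comp_sub hlam ht (g := fun z => latticeVariance (nu * max z 0))
      (fun z hz => by simp [max_eq_right hz])]
    congr 1
    refine integral_congr_ae ?_
    filter_upwards [expMeasure_ae_pos lam] with x hx
    rw [max_eq_left hx.le]
  have hS : ∫ p, latticeVariance (nu * p.2.2) ∂(queueLaw lam G tau)
      = ∫ s, latticeVariance (nu * s) ∂G :=
    integral_queueLaw_service (g := fun s => latticeVariance (nu * s)) hlam (hbdd measurable_id)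
  have hn : ∫ q, periodicAgeSum nu q.1 q.2 ∂((queueLaw lam G tau).prod (phaseLaw nu))
      = nu * ∫ p, (p.1 * interDeparture p + interDeparture p ^ 2 / 2) ∂(queueLaw lam G tau)
        + 1 / (2 * nu) * (laplace tau lam * ∫ x, latticeVariance (nu * x) ∂(expMeasure lam)
          + ∫ s, latticeVariance (nu * s) ∂G) := by
    have e := integral_add ((integrable_age_integral hlam hG htau hT).const_mul nu)
      ((iZ.add iS).const_mul (1 / (2 * nu)))
    simp only [Pi.add_apply] at e
    rw [integral_prod _ (integrable_periodicAgeSum hlam hnu hG htau hT), ← hZ, ← hS,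
      ← integral_add iZ iS, ← integral_const_mul, ← integral_const_mul, ← e]
    refine integral_congr_ae ?_
    filter_upwards [h0] with p hp using integral_periodicAgeSum hnu hp.2.2
  rw [periodicAuD, hn, hd, poissonAuD_eq hlam hG htau hnu, laplace_steady_rate hlam hG htau]
  generalize ∫ p, (p.1 * interDeparture p + interDeparture p ^ 2 / 2) ∂(queueLaw lam G tau) = V
  generalize ∫ s, s ∂G = m
  generalize ∫ x, latticeVariance (nu * x) ∂(expMeasure lam) = H
  generalize ∫ s, latticeVariance (nu * s) ∂G = R
  field_simp

end

/-! ### The excess age of periodic decisions -/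

/-- The function `(c / 2) * coth (c / 2)`. -/
noncomputable def halfCoth (c : ℝ) : ℝ := c * (1 + Real.exp (-c)) / (2 * (1 - Real.exp (-c)))

lemma one_sub_exp_neg_pos {c : ℝ} (hc : 0 < c) : 0 < 1 - Real.exp (-c) :=
  sub_pos.2 (Real.exp_lt_one_iff.2 (by linarith))

lemma hasDerivAt_halfCoth {c : ℝ} (hc : 0 < c) :
    HasDerivAt halfCoth
      ((1 - Real.exp (-c) ^ 2 - 2 * c * Real.exp (-c)) / (2 * (1 - Real.exp (-c)) ^ 2)) c := by
  have hpos := one_sub_exp_neg_pos hc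
  have he : HasDerivAt (fun x : ℝ => Real.exp (-x)) (-Real.exp (-c)) c := by
    simpa using (hasDerivAt_id c).neg.exp
  have h := ((hasDerivAt_id c).mul (he.const_add 1)).div ((he.const_sub 1).const_mul 2)
    (by positivity)
  refine h.congr_deriv ?_
  simp only [id, Pi.mul_apply]
  field_simp
  ring

/-- The numerator of the derivative is `2 e^{-c} (sinh c - c)`, which is positive for `c > 0`. -/
lemma halfCoth_strictMonoOn : StrictMonoOn halfCoth (Set.Ioi 0) := by
  refine strictMonoOn_of_deriv_pos (convex_Ioi 0)
    (fun c hc => (hasDerivAt_halfCoth hc).continuousAt.continuousWithinAt) ?_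
  intro c hc
  rw [interior_Ioi] at hc
  have hc : 0 < c := hc
  rw [(hasDerivAt_halfCoth hc).deriv]
  have hpos := one_sub_exp_neg_pos hc
  refine div_pos ?_ (by positivity)
  have h := Real.self_lt_sinh_iff.2 hc
  rw [Real.sinh_eq] at h
  have hmul : Real.exp c * Real.exp (-c) = 1 := by rw [← Real.exp_add]; simp
  have := Real.exp_pos (-c)
  nlinarith

lemma tendsto_halfCoth : Tendsto halfCoth (𝓝[>] 0) (𝓝 1) := by
  have h1 : Tendsto (fun c : ℝ => (1 - Real.exp (-c)) / c) (𝓝[>] 0) (𝓝 1) := by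
    simpa using tendsto_one_sub_exp_div 1
  have h2 : Tendsto (fun c : ℝ => (1 + Real.exp (-c)) / 2) (𝓝[>] 0) (𝓝 1) := by
    have : Tendsto (fun c : ℝ => (1 + Real.exp (-c)) / 2) (𝓝 0) (𝓝 ((1 + Real.exp (-0)) / 2)) :=
      Continuous.tendsto (by fun_prop) 0
    norm_num at this
    exact this.mono_left nhdsWithin_le_nhds
  have h := h2.div h1 one_ne_zero
  rw [div_one] at h
  refine h.congr' ?_
  filter_upwards [self_mem_nhdsWithin] with c (hc : 0 < c)
  have := (one_sub_exp_neg_pos hc).ne'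
  simp only [Pi.div_apply, halfCoth]
  field_simp

lemma latticeVariance_sub_one (z : ℝ) : latticeVariance (z - 1) = latticeVariance z := by
  simp [latticeVariance]

lemma latticeVariance_of_mem {z : ℝ} (h0 : 0 ≤ z) (h1 : z ≤ 1) :
    latticeVariance z = z * (1 - z) := by
  rcases h1.lt_or_eq with h | rfl
  · rw [latticeVariance, Int.fract_eq_self.2 ⟨h0, h⟩]
  · simp [latticeVariance]

lemma integral_first_period {lam nu : ℝ} (hlam : 0 < lam) (hnu : 0 < nu) :
    ∫ x in (0 : ℝ)..(1 / nu), lam * Real.exp (-(lam * x)) * (nu * x * (1 - nu * x))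
      = (1 + Real.exp (-(lam / nu))) * nu / lam
        - 2 * nu ^ 2 / lam ^ 2 * (1 - Real.exp (-(lam / nu))) := by
  -- Repeated integration by parts with `q = νx(1 - νx)` gives the antiderivative `-e^{-λx} (q +
  -- q'/λ + q''/λ²)`.
  have hderiv : ∀ x ∈ Set.uIcc (0 : ℝ) (1 / nu), HasDerivAt
      (fun x => -(Real.exp (-(lam * x)) * (nu * x * (1 - nu * x) + (nu - 2 * nu ^ 2 * x) / lam
        - 2 * nu ^ 2 / lam ^ 2)))
      (lam * Real.exp (-(lam * x)) * (nu * x * (1 - nu * x))) x := by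
    intro x _
    have hi := hasDerivAt_id x
    have he : HasDerivAt (fun x : ℝ => Real.exp (-(lam * x))) (Real.exp (-(lam * x)) * -lam) x := by
      simpa using (hi.const_mul lam).neg.exp
    have hp := (((hi.const_mul nu).mul ((hi.const_mul nu).const_sub 1)).add
      (((hi.const_mul (2 * nu ^ 2)).const_sub nu).div_const lam)).sub_const (2 * nu ^ 2 / lam ^ 2)
    refine ((he.mul hp).neg).congr_deriv ?_
    simp
    field_simp
    ring
  rw [intervalIntegral.integral_eq_sub_of_hasDerivAt hderiv
    (Continuous.intervalIntegrable (by fun_prop) _ _)]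
  have : lam * (1 / nu) = lam / nu := by ring
  rw [this]
  simp only [mul_zero, neg_zero, Real.exp_zero]
  field_simp
  ring

/-- A renewal argument: the integrand has period `1/ν`, so by lack of memory the part beyond the
first period is `e^{-λ/ν}` times the whole integral. Only the first period has to be computed. -/
lemma integral_latticeVariance_expMeasure {lam nu : ℝ} (hlam : 0 < lam) (hnu : 0 < nu) :
    (1 - Real.exp (-(lam / nu))) * ∫ x, latticeVariance (nu * x) ∂(expMeasure lam)
      = (1 + Real.exp (-(lam / nu))) * nu / lam
        - 2 * nu ^ 2 / lam ^ 2 * (1 - Real.exp (-(lam / nu))) := by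
  have := isProbabilityMeasure_expMeasure hlam
  have hinv : 0 < 1 / nu := by positivity
  have hm : Measurable (fun x : ℝ => latticeVariance (nu * x)) :=
    measurable_latticeVariance.comp (measurable_const_mul nu)
  have hbdd : ∀ {f : ℝ → ℝ}, Measurable f →
      (∀ x, f x = 0 ∨ ∃ y, f x = latticeVariance y) → Integrable f (expMeasure lam) := by
    intro f hf h
    refine Integrable.mono' (integrable_const 1) hf.aestronglyMeasurable (ae_of_all _ fun x => ?_)
    rcases h x with h | ⟨y, h⟩
    · simp [h]
    · rw [h, Real.norm_eq_abs, abs_of_nonneg (latticeVariance_nonneg _)]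
      exact latticeVariance_le_one _
  set g : ℝ → ℝ := (Set.Ioi 0).indicator (fun z => latticeVariance (nu * z)) with hg
  set f : ℝ → ℝ := (Set.Iic (1 / nu)).indicator (fun z => latticeVariance (nu * z)) with hf
  have hg0 : ∀ z ≤ 0, g z = 0 := fun z hz => by simp [hg, not_lt.2 hz]
  have hsplit : ∀ x, latticeVariance (nu * x) = f x + g (x - 1 / nu) := by
    intro x
    rcases le_or_gt x (1 / nu) with hx | hx
    · rw [hg0 _ (by linarith), hf, Set.indicator_of_mem (Set.mem_Iic.2 hx), add_zero]
    · have h1 : x ∉ Set.Iic (1 / nu) := by simpa using hx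
      have h2 : x - 1 / nu ∈ Set.Ioi 0 := by simpa using hx
      rw [hf, hg, Set.indicator_of_notMem h1, Set.indicator_of_mem h2, zero_add, mul_sub,
        mul_one_div_cancel hnu.ne', latticeVariance_sub_one]
  have hfi : Integrable f (expMeasure lam) := by
    refine hbdd (hm.indicator measurableSet_Iic) fun x => ?_
    by_cases hx : x ∈ Set.Iic (1 / nu)
    · exact Or.inr ⟨_, Set.indicator_of_mem hx _⟩
    · exact Or.inl (Set.indicator_of_notMem hx _)
  have hgi : Integrable (fun x => g (x - 1 / nu)) (expMeasure lam) := by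
    refine hbdd ((hm.indicator measurableSet_Ioi).comp (measurable_id.sub_const _)) fun x => ?_
    by_cases hx : x - 1 / nu ∈ Set.Ioi 0
    · exact Or.inr ⟨_, Set.indicator_of_mem hx _⟩
    · exact Or.inl (Set.indicator_of_notMem hx _)
  have hgint : ∫ x, g x ∂(expMeasure lam) = ∫ x, latticeVariance (nu * x) ∂(expMeasure lam) := by
    refine integral_congr_ae ?_
    filter_upwards [expMeasure_ae_pos lam] with x hx
    exact Set.indicator_of_mem (Set.mem_Ioi.2 hx) _
  have hfint : ∫ x, f x ∂(expMeasure lam)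
      = ∫ x in (0 : ℝ)..(1 / nu), lam * Real.exp (-(lam * x)) * (nu * x * (1 - nu * x)) := by
    rw [integral_expMeasure_Ioi hlam, intervalIntegral.integral_of_le hinv.le]
    have h1 : ∀ x, lam * Real.exp (-(lam * x)) * f x = (Set.Iic (1 / nu)).indicator
        (fun x => lam * Real.exp (-(lam * x)) * latticeVariance (nu * x)) x := by
      intro x
      by_cases hx : x ∈ Set.Iic (1 / nu)
      · rw [hf, Set.indicator_of_mem hx, Set.indicator_of_mem hx]
      · rw [hf, Set.indicator_of_notMem hx, Set.indicator_of_notMem hx, mul_zero]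
    simp only [h1]
    rw [integral_indicator measurableSet_Iic, Measure.restrict_restrict measurableSet_Iic,
      Set.inter_comm, Set.Ioi_inter_Iic]
    refine setIntegral_congr_fun measurableSet_Ioc fun x hx => ?_
    have h2 : nu * x ≤ 1 := by
      have := (le_div_iff₀ hnu).1 hx.2
      linarith
    simp only [latticeVariance_of_mem (mul_nonneg hnu.le hx.1.le) h2]
  have hI : ∫ x, latticeVariance (nu * x) ∂(expMeasure lam)
      = ∫ x, f x ∂(expMeasure lam)
        + Real.exp (-(lam / nu)) * ∫ x, latticeVariance (nu * x) ∂(expMeasure lam) := by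
    conv_lhs => simp only [hsplit]
    rw [integral_add hfi hgi, integral_expMeasure_comp_sub hlam hinv.le hg0, hgint, mul_one_div]
  rw [hfint, integral_first_period hlam hnu] at hI
  linear_combination hI

lemma latticeVariance_expMeasure_excess {lam nu : ℝ} (hlam : 0 < lam) (hnu : 0 < nu) :
    ∫ x, latticeVariance (nu * x) ∂(expMeasure lam)
      = 2 * nu ^ 2 / lam ^ 2 * (halfCoth (lam / nu) - 1) := by
  have hpos := one_sub_exp_neg_pos (div_pos hlam hnu)
  have h := integral_latticeVariance_expMeasure hlam hnu
  rw [halfCoth]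
  generalize ∫ x, latticeVariance (nu * x) ∂(expMeasure lam) = I at h ⊢
  generalize Real.exp (-(lam / nu)) = u at h hpos ⊢
  rw [← mul_right_inj' hpos.ne', h]
  field_simp

lemma integral_latticeVariance_unit : ∫ x in (0 : ℝ)..1, latticeVariance x = 1 / 6 := by
  have : ∫ x in (0 : ℝ)..1, latticeVariance x = ∫ x in (0 : ℝ)..1, (x - x ^ 2) := by
    refine intervalIntegral.integral_congr fun x hx => ?_
    rw [Set.uIcc_of_le zero_le_one] at hx
    simp only [latticeVariance_of_mem hx.1 hx.2]
    ring
  rw [this, intervalIntegral.integral_sub (by simp) (by simp)]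
  simp
  norm_num

lemma integral_latticeVariance_nat (n : ℕ) :
    ∫ x in (0 : ℝ)..n, latticeVariance x = n / 6 := by
  have hper : Function.Periodic latticeVariance 1 := by
    intro x
    simp [latticeVariance]
  have hint : ∀ a b : ℝ, IntervalIntegrable latticeVariance volume a b := by
    intro a b
    refine intervalIntegrable_iff.2 (Measure.integrableOn_of_bounded (M := 1) (by simp)
      measurable_latticeVariance.aestronglyMeasurable (ae_of_all _ fun x => ?_))
    rw [Real.norm_eq_abs, abs_of_nonneg (latticeVariance_nonneg _)]
    exact latticeVariance_le_one _
  have h := hper.intervalIntegral_add_zsmul_eq n 0 hint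
  simp only [zero_add, integral_latticeVariance_unit] at h
  simp at h
  rw [h]
  ring

/-! ### The three service laws -/

lemma isProbabilityMeasure_serviceLaw_uniform {mu : ℝ} (hmu : 0 < mu) :
    IsProbabilityMeasure (serviceLaw mu .uniform) := by
  apply ProbabilityTheory.cond_isProbabilityMeasure_of_finite
  · simpa using hmu
  · simp

lemma integral_serviceLaw_uniform {mu : ℝ} (hmu : 0 < mu) (f : ℝ → ℝ) :
    ∫ s, f s ∂(serviceLaw mu .uniform) = mu / 2 * ∫ s in (0 : ℝ)..(2 / mu), f s := by
  have h : 0 < 2 / mu := by positivity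
  rw [serviceLaw, ProbabilityTheory.cond, integral_smul_measure, integral_Icc_eq_integral_Ioc,
    ← intervalIntegral.integral_of_le h.le, Real.volume_Icc, ENNReal.toReal_inv, sub_zero,
    ENNReal.toReal_ofReal h.le, smul_eq_mul, inv_div]

lemma isServiceLaw_serviceLaw {mu : ℝ} (hmu : 0 < mu) (G : ServiceType) :
    IsServiceLaw (serviceLaw mu G) := by
  cases G with
  | uniform =>
    have := isProbabilityMeasure_serviceLaw_uniform hmu
    have hmem : ∀ᵐ s ∂(serviceLaw mu .uniform), s ∈ Set.Icc 0 (2 / mu) :=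
      ProbabilityTheory.ae_cond_mem measurableSet_Icc
    refine ⟨this, hmem.mono fun s hs => hs.1, ?_⟩
    refine Integrable.mono' (integrable_const ((2 / mu) ^ 2)) (by fun_prop) ?_
    filter_upwards [hmem] with s hs
    rw [Real.norm_eq_abs, abs_of_nonneg (by positivity)]
    exact pow_le_pow_left₀ hs.1 hs.2 2
  | exponential =>
    exact ⟨isProbabilityMeasure_expMeasure hmu, (expMeasure_ae_pos mu).mono fun s hs => hs.le,
      integrable_pow_expMeasure hmu 2⟩
  | deterministic =>
    refine ⟨by unfold serviceLaw; infer_instance, ?_, ?_⟩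
    · simp only [serviceLaw]
      rw [ae_dirac_eq]
      simp [hmu.le]
    · exact integrable_dirac (by simp)

lemma integral_id_serviceLaw {mu : ℝ} (hmu : 0 < mu) (G : ServiceType) :
    ∫ s, s ∂(serviceLaw mu G) = 1 / mu := by
  cases G with
  | uniform =>
    rw [integral_serviceLaw_uniform hmu, integral_id]
    field_simp
    ring
  | exponential => exact integral_id_expMeasure hmu
  | deterministic => simp [serviceLaw]

lemma integral_sq_serviceLaw {mu : ℝ} (hmu : 0 < mu) (G : ServiceType) :
    ∫ s, s ^ 2 ∂(serviceLaw mu G)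
      = match G with
        | .uniform => 4 / (3 * mu ^ 2)
        | .exponential => 2 / mu ^ 2
        | .deterministic => 1 / mu ^ 2 := by
  cases G with
  | uniform =>
    rw [integral_serviceLaw_uniform hmu, integral_pow, div_pow]
    field_simp
    ring
  | exponential => exact integral_sq_expMeasure hmu
  | deterministic => simp [serviceLaw]

lemma laplace_serviceLaw {lam mu : ℝ} (hlam : 0 < lam) (hmu : 0 < mu) (G : ServiceType) :
    laplace (serviceLaw mu G) lam
      = match G with
        | .uniform => (1 - Real.exp (-(2 * (lam / mu)))) / (2 * (lam / mu))
        | .exponential => mu / (mu + lam)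
        | .deterministic => Real.exp (-(lam / mu)) := by
  cases G with
  | uniform =>
    have hderiv : ∀ x ∈ Set.uIcc (0 : ℝ) (2 / mu), HasDerivAt
        (fun x => -Real.exp (-(lam * x)) / lam) (Real.exp (-(lam * x))) x := by
      intro x _
      have he : HasDerivAt (fun x : ℝ => Real.exp (-(lam * x)))
          (Real.exp (-(lam * x)) * -lam) x := by
        simpa using ((hasDerivAt_id x).const_mul lam).neg.exp
      refine (he.neg.div_const lam).congr_deriv ?_
      field_simp
    rw [laplace, integral_serviceLaw_uniform hmu,
      intervalIntegral.integral_eq_sub_of_hasDerivAt hderiv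
        (Continuous.intervalIntegrable (by fun_prop) _ _),
      show lam * (2 / mu) = 2 * (lam / mu) by ring]
    simp only [mul_zero, neg_zero, Real.exp_zero]
    field_simp
    ring
  | exponential =>
    have h := integral_exp_mul_expMeasure hmu (s := -lam) (by linarith)
    simpa [laplace, serviceLaw, neg_mul] using h
  | deterministic => simp [laplace, serviceLaw, div_eq_mul_inv]

lemma poissonAuD_serviceLaw {lam mu : ℝ} (hlam : 0 < lam) (hmu : lam < mu) (G : ServiceType)
    {tau : Measure ℝ} (htau : IsSteadySystemTime lam (serviceLaw mu G) tau) {nu : ℝ}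
    (hnu : 0 < nu) :
    poissonAuD lam nu (serviceLaw mu G) tau = poissonFormula lam mu G := by
  have hmu0 : 0 < mu := hlam.trans hmu
  have hrho : lam * ∫ s, s ∂(serviceLaw mu G) < 1 := by
    rw [integral_id_serviceLaw hmu0, mul_one_div, div_lt_one hmu0]
    exact hmu
  rw [poissonAuD_closed_form hlam (isServiceLaw_serviceLaw hmu0 G) htau hrho hnu,
    integral_id_serviceLaw hmu0, integral_sq_serviceLaw hmu0, laplace_serviceLaw hlam hmu0,
    poissonFormula]
  have hr0 : 0 < lam / mu := div_pos hlam hmu0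
  have hr1 : lam / mu < 1 := (div_lt_one hmu0).2 hmu
  obtain ⟨r, hr⟩ : ∃ r, r = lam / mu := ⟨_, rfl⟩
  -- Eliminating `lam` in favour of `r` and `mu` makes the comparison rational in these and one
  -- exponential.
  have hl : lam = r * mu := by rw [hr]; field_simp
  rw [← hr] at hr0 hr1 ⊢
  have h1r : 1 - r ≠ 0 := by linarith
  have h1 : 1 - lam * (1 / mu) = 1 - r := by rw [hl]; field_simp
  rw [h1]
  subst hl
  cases G with
  | uniform =>
    have hE : 1 < Real.exp (2 * r) := Real.one_lt_exp_iff.2 (by linarith)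
    simp only [poissonExpr, Real.exp_neg]
    generalize Real.exp (2 * r) = E at hE ⊢
    have hE1 : E - 1 ≠ 0 := by linarith
    have hE2 : 1 - E⁻¹ = (E - 1) / E := by field_simp
    rw [hE2]
    field_simp
    ring
  | exponential =>
    have : mu + r * mu ≠ 0 := by positivity
    simp only [poissonExpr]
    field_simp
    ring
  | deterministic =>
    simp only [poissonExpr, Real.exp_neg]
    have := (Real.exp_pos r).ne'
    field_simp
    ring

/-- Integrality of `m` enters here: `[0, 2/μ]` consists of `2m` full periods, giving the mean `1/6`
over a period, and `1/μ` is exactly `m` periods, so the count is not random. -/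
lemma integral_latticeVariance_serviceLaw {mu : ℝ} (hmu : 0 < mu) (G : ServiceType) {m : ℕ}
    (hm : 1 ≤ m) :
    ∫ s, latticeVariance (m * mu * s) ∂(serviceLaw mu G)
      = match G with
        | .uniform => 1 / 6
        | .exponential => 2 * (m : ℝ) ^ 2 * (halfCoth (1 / m) - 1)
        | .deterministic => 0 := by
  have hm0 : (0 : ℝ) < m := by exact_mod_cast hm
  cases G with
  | uniform =>
    rw [integral_serviceLaw_uniform hmu, intervalIntegral.integral_comp_mul_left _ (by positivity),
      mul_zero, show (m : ℝ) * mu * (2 / mu) = ((2 * m : ℕ) : ℝ) by push_cast; field_simp,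
      integral_latticeVariance_nat, smul_eq_mul]
    push_cast
    field_simp
  | exponential =>
    have h := latticeVariance_expMeasure_excess hmu (mul_pos hm0 hmu)
    rw [show mu / (m * mu) = 1 / (m : ℝ) by field_simp] at h
    refine h.trans ?_
    field_simp
  | deterministic =>
    simp only [serviceLaw]
    rw [integral_dirac, mul_assoc, mul_one_div_cancel hmu.ne', mul_one]
    simp [latticeVariance]

/-! ### Monotonicity in the decision rate -/

/-- The excess age of periodic decisions, as a function of the decision rate. -/
noncomputable def periodicExcess (a r b c d : ℝ) (m : ℕ) : ℝ :=
  a * (halfCoth (r / m) - 1) + b * (halfCoth (1 / m) - 1) + c / m + d / (m : ℝ) ^ 2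

lemma tendsto_halfCoth_div {r : ℝ} (hr : 0 < r) :
    Tendsto (fun m : ℕ => halfCoth (r / m)) atTop (𝓝 1) := by
  refine tendsto_halfCoth.comp (tendsto_nhdsWithin_iff.2
    ⟨tendsto_const_div_atTop_nhds_zero_nat r, ?_⟩)
  filter_upwards [eventually_ge_atTop 1] with m hm
  have : (0 : ℝ) < m := by exact_mod_cast hm
  exact div_pos hr this

lemma halfCoth_div_strictAntiOn {r : ℝ} (hr : 0 < r) :
    StrictAntiOn (fun m : ℕ => halfCoth (r / m)) (Set.Ici 1) := by
  intro m hm n hn hmn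
  have hm0 : (0 : ℝ) < m := by exact_mod_cast Set.mem_Ici.1 hm
  have hmn' : (m : ℝ) < n := by exact_mod_cast hmn
  exact halfCoth_strictMonoOn (div_pos hr (hm0.trans hmn')) (div_pos hr hm0)
    (div_lt_div_of_pos_left hr hm0 hmn')

section

variable {a r b c d : ℝ}

/-- Strictness comes from the idle-time term with coefficient `a` alone, so it survives when the
service time contributes nothing. -/
lemma periodicExcess_strictAntiOn (ha : 0 < a) (hr : 0 < r) (hb : 0 ≤ b) (hc : 0 ≤ c)
    (hd : 0 ≤ d) : StrictAntiOn (periodicExcess a r b c d) (Set.Ici 1) := by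
  intro m hm n hn hmn
  have hm0 : (0 : ℝ) < m := by exact_mod_cast Set.mem_Ici.1 hm
  have hmn' : (m : ℝ) < n := by exact_mod_cast hmn
  have h1 := mul_lt_mul_of_pos_left (halfCoth_div_strictAntiOn hr hm hn hmn) ha
  have h2 := mul_le_mul_of_nonneg_left (halfCoth_div_strictAntiOn one_pos hm hn hmn).le hb
  have h3 : c / n ≤ c / m := div_le_div_of_nonneg_left hc hm0 hmn'.le
  have h4 : d / (n : ℝ) ^ 2 ≤ d / (m : ℝ) ^ 2 :=
    div_le_div_of_nonneg_left hd (by positivity) (pow_le_pow_left₀ hm0.le hmn'.le 2)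
  simp only [periodicExcess]
  linarith

lemma tendsto_periodicExcess (hr : 0 < r) :
    Tendsto (periodicExcess a r b c d) atTop (𝓝 0) := by
  have h1 := ((tendsto_halfCoth_div hr).sub_const 1).const_mul a
  have h2 := ((tendsto_halfCoth_div one_pos).sub_const 1).const_mul b
  have h3 := tendsto_const_div_atTop_nhds_zero_nat c
  have h4 := tendsto_const_div_pow d 2 two_ne_zero
  have h := ((h1.add h2).add h3).add h4
  simp only [sub_self, mul_zero, add_zero] at h
  exact h

/-- Sequences that differ from a constant by a periodic excess decrease strictly to it. -/
lemma antitone_limit_of_eq_add_periodicExcess (ha : 0 < a) (hr : 0 < r) (hb : 0 ≤ b) (hc : 0 ≤ c)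
    (hd : 0 ≤ d) {f : ℕ → ℝ} {A : ℝ} (hf : ∀ m, 1 ≤ m → f m = A + periodicExcess a r b c d m) :
    (∀ m, 1 ≤ m → A ≤ f m) ∧ StrictAntiOn f (Set.Ici 1) ∧ Tendsto f atTop (𝓝 A) := by
  have hanti : StrictAntiOn f (Set.Ici 1) := by
    intro m hm n hn hmn
    rw [hf m hm, hf n hn]
    have := periodicExcess_strictAntiOn ha hr hb hc hd hm hn hmn
    linarith
  have hlim : Tendsto f atTop (𝓝 A) := by
    have h := (tendsto_periodicExcess (a := a) (b := b) (c := c) (d := d) hr).const_add A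
    rw [add_zero] at h
    refine h.congr' ?_
    filter_upwards [eventually_ge_atTop 1] with m hm using (hf m hm).symm
  refine ⟨fun m hm => le_of_tendsto hlim ?_, hanti, hlim⟩
  filter_upwards [eventually_ge_atTop m] with n hn
  exact hanti.antitoneOn hm (hm.trans hn) hn

end

/-! ### Exact and explicit averages as the Poisson value plus an excess -/

section

variable {lam mu : ℝ}

lemma periodicAuD_serviceLaw (hlam : 0 < lam) (hmu : lam < mu) (G : ServiceType)
    {tau : Measure ℝ} (htau : IsSteadySystemTime lam (serviceLaw mu G) tau) {m : ℕ}
    (hm : 1 ≤ m) :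
    periodicAuD lam (m * mu) (serviceLaw mu G) tau
      = poissonFormula lam mu G + match G with
        | .uniform => periodicExcess ((1 - lam / mu) / lam) (lam / mu) 0 0 (lam / (12 * mu ^ 2)) m
        | .exponential => periodicExcess ((1 - lam / mu) / lam) (lam / mu) (lam / mu ^ 2) 0 0 m
        | .deterministic => periodicExcess ((1 - lam / mu) / lam) (lam / mu) 0 0 0 m := by
  have hmu0 : 0 < mu := hlam.trans hmu
  have hm0 : (0 : ℝ) < m := by exact_mod_cast hm
  have hnu : 0 < m * mu := by positivity
  have hrho : lam * ∫ s, s ∂(serviceLaw mu G) < 1 := by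
    rw [integral_id_serviceLaw hmu0, mul_one_div, div_lt_one hmu0]
    exact hmu
  rw [periodicAuD_eq hlam hnu (isServiceLaw_serviceLaw hmu0 G) htau hrho,
    poissonAuD_serviceLaw hlam hmu G htau hnu, latticeVariance_expMeasure_excess hlam hnu,
    integral_latticeVariance_serviceLaw hmu0 G hm, integral_id_serviceLaw hmu0,
    show lam / (m * mu) = lam / mu / m by field_simp]
  congr 1
  cases G <;> simp only [periodicExcess] <;> generalize halfCoth (lam / mu / m) = K
  · field_simp
    ring
  · generalize halfCoth (1 / m) = K'
    field_simp
    ring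
  · field_simp
    ring

lemma coth_term_eq {c r m : ℝ} (hc : c = r / m) (hr : 0 < r) (hm : 0 < m) :
    (1 + Real.exp (-c)) / (2 * mu * m * (1 - Real.exp (-c))) = halfCoth c / (mu * r) := by
  have hpos := one_sub_exp_neg_pos (c := c) (by rw [hc]; positivity)
  rw [halfCoth, hc] at *
  field_simp

/-- For exponential and deterministic service the excess is the exact one. For uniform service the
`1/m²` coefficient agrees with the exact one as well, and the coarser approximation shows only in
the additional `1/m` term. -/
lemma periodicFormula_eq (hlam : 0 < lam) (hmu : lam < mu) (G : ServiceType) {m : ℕ}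
    (hm : 1 ≤ m) :
    periodicFormula lam mu G m
      = poissonFormula lam mu G + match G with
        | .uniform => periodicExcess ((1 - lam / mu) / lam) (lam / mu) 0
            ((3 - (lam / mu) ^ 2) / (6 * mu * (1 - lam / mu))) (lam / mu / (12 * mu)) m
        | .exponential => periodicExcess ((1 - lam / mu) / lam) (lam / mu) (lam / mu ^ 2) 0 0 m
        | .deterministic => periodicExcess ((1 - lam / mu) / lam) (lam / mu) 0 0 0 m := by
  have hmu0 : 0 < mu := hlam.trans hmu
  have hm0 : (0 : ℝ) < m := by exact_mod_cast hm
  have hr0 : 0 < lam / mu := div_pos hlam hmu0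
  have hr1 : lam / mu < 1 := (div_lt_one hmu0).2 hmu
  obtain ⟨r, hr⟩ : ∃ r, r = lam / mu := ⟨_, rfl⟩
  have hl : lam = r * mu := by rw [hr]; field_simp
  have h1r : 1 - r ≠ 0 := by linarith
  rw [periodicFormula, poissonFormula, show lam / (m * mu) = lam / mu / m by field_simp,
    show mu / (m * mu) = 1 / (m : ℝ) by field_simp]
  have t1 := coth_term_eq (mu := mu) (c := lam / mu / m) rfl hr0 hm0
  have t2 := coth_term_eq (mu := mu) (c := 1 / m) rfl one_pos hm0
  rw [← hr] at hr0 hr1 t1 ⊢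
  subst hl
  cases G with
  | uniform =>
    have hE : 1 < Real.exp (2 * r) := Real.one_lt_exp_iff.2 (by linarith)
    simp only [periodicExpr, poissonExpr, periodicExcess, mul_div_assoc (1 - r), t1]
    generalize Real.exp (2 * r) = E at hE ⊢
    generalize halfCoth (r / m) = K
    have hE1 : E - 1 ≠ 0 := by linarith
    field_simp
    ring
  | exponential =>
    simp only [periodicExpr, poissonExpr, periodicExcess, mul_div_assoc (1 - r), mul_div_assoc r,
      t1, t2]
    generalize halfCoth (r / m) = K
    generalize halfCoth (1 / m) = K'
    field_simp
    ring
  | deterministic =>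
    simp only [periodicExpr, poissonExpr, periodicExcess, mul_div_assoc (1 - r), t1]
    generalize Real.exp r = E
    generalize halfCoth (r / m) = K
    field_simp
    ring

end
-- The main theorem
theorem proposition2 (lam mu : ℝ) (hlam : 0 < lam) (hmu : lam < mu) (G : ServiceType) :
    (∀ tau : Measure ℝ, IsSteadySystemTime lam (serviceLaw mu G) tau →
      -- periodic decisions are never better than Poisson decisions of the same rate
      (∀ m : ℕ, 1 ≤ m →
        poissonAuD lam (m * mu) (serviceLaw mu G) tau
          ≤ periodicAuD lam (m * mu) (serviceLaw mu G) tau) ∧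
      -- the average age under periodic decisions decreases with the decision rate
      StrictAntiOn (fun m : ℕ => periodicAuD lam (m * mu) (serviceLaw mu G) tau) (Set.Ici 1) ∧
      -- the average age under Poisson decisions, for every decision rate
      (∀ nu : ℝ, 0 < nu →
        poissonAuD lam nu (serviceLaw mu G) tau = poissonFormula lam mu G) ∧
      -- equality in the limit
      Tendsto (fun m : ℕ => periodicAuD lam (m * mu) (serviceLaw mu G) tau) atTop
        (𝓝 (poissonFormula lam mu G)) ∧
      -- the explicit expressions are exact for exponential and deterministic service
      (G ≠ ServiceType.uniform → ∀ m : ℕ, 1 ≤ m →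
        periodicAuD lam (m * mu) (serviceLaw mu G) tau = periodicFormula lam mu G m)) ∧
    -- the same conclusions for the explicit expressions
    (∀ m : ℕ, 1 ≤ m → poissonFormula lam mu G ≤ periodicFormula lam mu G m) ∧
    StrictAntiOn (fun m : ℕ => periodicFormula lam mu G m) (Set.Ici 1) ∧
    Tendsto (fun m : ℕ => periodicFormula lam mu G m) atTop (𝓝 (poissonFormula lam mu G)) := by
  have hmu0 : 0 < mu := hlam.trans hmu
  have hr0 : 0 < lam / mu := div_pos hlam hmu0
  have hr1 : 0 < 1 - lam / mu := sub_pos.2 ((div_lt_one hmu0).2 hmu)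
  have ha : 0 < (1 - lam / mu) / lam := div_pos hr1 hlam
  have hb : 0 ≤ lam / mu ^ 2 := by positivity
  constructor
  · intro tau htau
    have hlim : (∀ m : ℕ, 1 ≤ m →
          poissonFormula lam mu G ≤ periodicAuD lam (m * mu) (serviceLaw mu G) tau) ∧
        StrictAntiOn (fun m : ℕ => periodicAuD lam (m * mu) (serviceLaw mu G) tau) (Set.Ici 1) ∧
        Tendsto (fun m : ℕ => periodicAuD lam (m * mu) (serviceLaw mu G) tau) atTop
          (𝓝 (poissonFormula lam mu G)) := by
      cases G with
      | uniform =>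
        exact antitone_limit_of_eq_add_periodicExcess ha hr0 le_rfl le_rfl
          (div_nonneg hlam.le (by positivity))
          fun m hm => periodicAuD_serviceLaw hlam hmu .uniform htau hm
      | exponential =>
        exact antitone_limit_of_eq_add_periodicExcess ha hr0 hb le_rfl le_rfl
          fun m hm => periodicAuD_serviceLaw hlam hmu .exponential htau hm
      | deterministic =>
        exact antitone_limit_of_eq_add_periodicExcess ha hr0 le_rfl le_rfl le_rfl
          fun m hm => periodicAuD_serviceLaw hlam hmu .deterministic htau hm
    refine ⟨fun m hm => ?_, hlim.2.1, fun nu hnu => poissonAuD_serviceLaw hlam hmu G htau hnu,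
      hlim.2.2, fun hG m hm => ?_⟩
    · have hm0 : (0 : ℝ) < m := by exact_mod_cast hm
      rw [poissonAuD_serviceLaw hlam hmu G htau (mul_pos hm0 hmu0)]
      exact hlim.1 m hm
    · rw [periodicAuD_serviceLaw hlam hmu G htau hm, periodicFormula_eq hlam hmu G hm]
      cases G with
      | uniform => exact absurd rfl hG
      | exponential => rfl
      | deterministic => rfl
  · cases G with
    | uniform =>
      -- The utilization is below 1, so the additional `1/m` term of the coarser formula has the
      -- right sign and does not spoil monotonicity.
      have hc : 0 ≤ (3 - (lam / mu) ^ 2) / (6 * mu * (1 - lam / mu)) :=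
        div_nonneg (by nlinarith) (by positivity)
      exact antitone_limit_of_eq_add_periodicExcess ha hr0 le_rfl hc (by positivity)
        fun m hm => periodicFormula_eq hlam hmu .uniform hm
    | exponential =>
      exact antitone_limit_of_eq_add_periodicExcess ha hr0 hb le_rfl le_rfl
        fun m hm => periodicFormula_eq hlam hmu .exponential hm
    | deterministic =>
      exact antitone_limit_of_eq_add_periodicExcess ha hr0 le_rfl le_rfl le_rfl
        fun m hm => periodicFormula_eq hlam hmu .deterministic hm
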